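/- **Setting.** For $i=1,\dots,\ell$ let $(G_i,B_i,T_i)$ be obtained from the standard triple ($\mathrm{SL}(2,\mathbb C)$, upper triangular matrices, diagonal matrices) by enlarging the diagonal torus $\mathsf T_{\alpha_i}$ to a complex torus $T_i$: $G_i=\mathrm{SL}(2,\mathbb C)\,T_i$ is a complex algebraic group in which $\mathrm{SL}(2,\mathbb C)$ is normal, $\mathrm{SL}(2,\mathbb C)\cap T_i=\mathsf T_{\alpha_i}$, and $B_i=T_iN_i$ with $N_i=\{e^{xE_{\alpha_i}}\}$ the upper triangular unipotent matrices. Let $\alpha_i$ be the root, $H_{\alpha_i}$ the coroot, $s_i$ the reflection, and let $\gamma:T_{i}\to T_{i-1}$ be algebraic homomorphisms, extended to $B_i$ trivially on $N_i$. Put $G_{\rm s}=\prod G_i$, $B_{\rm s}=\prod B_i$, $T_{\rm s}=\prod T_i$. The toric $\mathbb P^1$-chain is $\mathcal X=G_{\rm s}/B_{\rm s}$ for the right action $(g\cdot b)_i=\gamma(b_{i+1})^{-1}g_ib_i$ (for $i=\ell$, $(g\cdot b)_\ell=g_\ell b_\ell$); $T_{\rm s}$ acts on it by left multiplication. Let $\lambda=(\lambda_i)$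 be a weight of $T_{\rm s}$ and $\tilde\lambda_i=\lambda_i-(s_{i-1}\lambda_{i-1})\circ\gamma$ (with $\tilde\lambda_1=\lambda_1$). The holomorphic line bundle $\mathcal L=\mathcal L_\lambda$ on $\mathcal X$ has as sections the holomorphic functions with $f(g\cdot b)=f(g)b^{\tilde\lambda}$; let $\mathcal H$ be the space of its global holomorphic sections. $\mathcal L$ carries the unitary metric with $|f(\xi)|=|f(u)|$ whenever $\xi$ is represented by $u\in U_{\rm s}=\prod U_i$, $U_i$ being the compact form of $G_i$ (that is, $\mathrm{SU}(2)$ times the compact part of $T_i$). Assume that $\lambda$ satisfies the positivity condition: the curvature form $\sigma_\lambda=-\frac1{2\pi i}\bar\partial\partial\log|f|^2$ ($f$ any local non-vanishing holomorphic section) is positive definite at every point of $\mathcal X$. Let $(z_i)$ be the affine coordinates, for which the point with coordinates $z$ is represented by $(e^{z_iE_{\alpha_i}}s_i)_i$; $T_{\rm s}$ acts on them by weights $\varpi_i$, $z_i(h\xi)=h^{\varpi_i}z_i(\xi)$. Write $z_i=e^{\tau_i+\sqrt{-1}\phi_i}$. Let $c^\lambda(g)=\prod_i c(s_ig_i)^{\lambda_i}$,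 where $c(g_i)$ is the $T_i$-component of $g_i\in N_i^-T_iN_i$ ($N_i^-$ the lower triangular unipotent matrices); it is a meromorphic section of $\mathcal L$, holomorphic and without zeros on the coordinate domain. The moment map $\pi=\sum_iJ_i\varpi_i$ is the continuous extension to $\mathcal X$ of $J_i=\frac12\,\partial K/\partial\tau_i$, $K=-\log|c^\lambda|^2$; its image $\pi(\mathcal X)$ is the moment polytope. An integral point is an element $\eta=\sum n_i\varpi_i$ with $n_i\in\mathbb Z$; put $f_\eta=z^\eta c^\lambda=z_1^{n_1}\cdots z_\ell^{n_\ell}c^\lambda$. Let $T$ be the image of $T_{\rm s}$ as a group of transformations of $\mathcal X$. The element $h\in T$ acts on $\mathcal H$ by pull-back, $f\mapsto f(h\,\cdot)$, where the action on $\mathcal X$ is lifted to $\mathcal L$ so that $c^\lambda$ is invariant; i.e. $\varphi c^\lambda\mapsto(\varphi\circ h)c^\lambda$ for meromorphic functions $\varphi$. For $H$ in the Lie algebra of the positive real part of $T$, $e^{iH}$ lies in the compact part of $T$. **Statement.** The space $\mathcal H$ is finite-dimensional. The weight set $\Pi$ of those integral points $\eta$ for which $f_\eta$ extends to a global holomorphic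 section of $\mathcal L$ is finite, and it is the set of all integral points $\eta\in\pi(\mathcal X)$. For every $H$, $$Z(iH):=\operatorname{trace}\bigl(e^{iH}\mid\mathcal H\bigr)=\sum_{\eta\in\Pi}e^{i\eta(H)} .$$ Equivalently, for the representation $(U_hf)(\xi)=f(h^{-1}\xi)$ one has $\operatorname{trace}(U_{e^{iH}}\mid\mathcal H)=\sum_{\eta\in\Pi}e^{-i\eta(H)}$. -/

import Mathlib

open Complex

/-! ### Subgroups of `SL(2, ℂ)` -/

namespace SL2

/-- The group `SL(2, ℂ)`. -/
abbrev Grp : Type := Matrix.SpecialLinearGroup (Fin 2) ℂ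

/-- `exp (z E_α)`, an element of the group `N` of upper triangular unipotent matrices. -/
def upper (z : ℂ) : Grp := ⟨!![1, z; 0, 1], by simp [Matrix.det_fin_two]⟩

/-- `exp (z E_{-α})`, an element of the group `N⁻` of lower triangular unipotent matrices. -/
def lower (z : ℂ) : Grp := ⟨!![1, 0; z, 1], by simp [Matrix.det_fin_two]⟩

/-- The diagonal matrix with entries `x, x⁻¹`. -/
def diag (x : ℂˣ) : Grp := ⟨!![(x : ℂ), 0; 0, ((x⁻¹ : ℂˣ) : ℂ)], by simp [Matrix.det_fin_two]⟩

/-- The representative of the reflection; it acts on the affine coordinate by `z ↦ -1/z`. -/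
def refl : Grp := ⟨!![0, 1; -1, 0], by simp [Matrix.det_fin_two]⟩

/-- Conjugation of `g` by the diagonal matrix with entries `x, 1`. It is the identity on diagonal
matrices, and sends `exp (z E_{±α})` to `exp (x^{±1} z E_{±α})`. -/
def twist (x : ℂˣ) (g : Grp) : Grp :=
  ⟨!![g 0 0, (x : ℂ) * g 0 1; ((x⁻¹ : ℂˣ) : ℂ) * g 1 0, g 1 1], by
    have h := g.det_coe
    rw [Matrix.det_fin_two] at h
    have hx : (x : ℂ) * ((x⁻¹ : ℂˣ) : ℂ) = 1 := by simp
    rw [Matrix.det_fin_two_of]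
    linear_combination h - (g 0 1 * g 1 0) * hx⟩

/-- Every element of `SL(2, ℂ)` is the product of an element of `SU(2)` and of an upper triangular
matrix. -/
lemma exists_iwasawa (a : Grp) : ∃ (k : Grp) (r : ℂˣ) (x : ℂ),
    (k : Matrix (Fin 2) (Fin 2) ℂ) ∈ Matrix.unitaryGroup (Fin 2) ℂ ∧
    a = k * diag r * upper x := by
  have hdet := a.det_coe
  rw [Matrix.det_fin_two] at hdet
  set p := a 0 0 with hp
  set q := a 1 0 with hq
  set b := a 0 1 with hb
  set d := a 1 1 with hd
  have hpos : 0 < ‖p‖ ^ 2 + ‖q‖ ^ 2 := by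
    by_contra hcon
    have h1 : ‖p‖ = 0 := by nlinarith [sq_nonneg ‖p‖, sq_nonneg ‖q‖]
    have h2 : ‖q‖ = 0 := by nlinarith [sq_nonneg ‖p‖, sq_nonneg ‖q‖]
    rw [norm_eq_zero] at h1 h2
    simp [h1, h2] at hdet
  obtain ⟨r, hr0, hr⟩ : ∃ r : ℝ, r ≠ 0 ∧ r ^ 2 = ‖p‖ ^ 2 + ‖q‖ ^ 2 :=
    ⟨Real.sqrt (‖p‖ ^ 2 + ‖q‖ ^ 2), (Real.sqrt_pos.2 hpos).ne', Real.sq_sqrt hpos.le⟩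
  have hrc : (r : ℂ) ≠ 0 := by exact_mod_cast hr0
  have hr2 : (r : ℂ) ^ 2 = p * (starRingEnd ℂ) p + q * (starRingEnd ℂ) q := by
    rw [Complex.mul_conj', Complex.mul_conj']
    exact_mod_cast hr
  have hk : Matrix.det !![p / r, -(starRingEnd ℂ) q / r; q / r, (starRingEnd ℂ) p / r] = 1 := by
    rw [Matrix.det_fin_two_of]
    field_simp
    linear_combination -hr2
  obtain ⟨k, hkm⟩ : ∃ k : Grp, (k : Matrix (Fin 2) (Fin 2) ℂ) =
      !![p / r, -(starRingEnd ℂ) q / r; q / r, (starRingEnd ℂ) p / r] := ⟨⟨_, hk⟩, rfl⟩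
  refine ⟨k, Units.mk0 r hrc,
    ((starRingEnd ℂ) p * b + (starRingEnd ℂ) q * d) / (r : ℂ) ^ 2, ?_, ?_⟩
  · rw [hkm, Matrix.mem_unitaryGroup_iff']
    ext i j
    fin_cases i <;> fin_cases j <;>
      simp [Matrix.mul_apply, Fin.sum_univ_two, Matrix.star_apply] <;> field_simp <;>
      first | linear_combination -hr2 | ring
  · ext i j
    rw [Matrix.SpecialLinearGroup.coe_mul, Matrix.SpecialLinearGroup.coe_mul, hkm]
    fin_cases i <;> fin_cases j <;>
      simp [Matrix.mul_apply, Fin.sum_univ_two, diag, upper, ← hp, ← hq, ← hb, ← hd] <;>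
      field_simp
    · linear_combination b * hr2 - (starRingEnd ℂ) q * hdet
    · linear_combination d * hr2 + (starRingEnd ℂ) p * hdet

end SL2

/-! ### Tori -/

namespace Torus

/-- The value `t ^ μ` of the weight `μ` of the torus `(ℂˣ)ⁿ` at `t`. -/
def char {n : ℕ} (μ : Fin n → ℤ) (t : Fin n → ℂˣ) : ℂˣ := ∏ k, t k ^ μ k

/-- The exponential map of the torus `(ℂˣ)ⁿ`. -/
noncomputable def exp {n : ℕ} (y : Fin n → ℂ) : Fin n → ℂˣ :=
  fun k => Units.mk0 (Complex.exp (y k)) (Complex.exp_ne_zero _)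

/-- The algebraic homomorphism of tori `(ℂˣ)ᵐ → (ℂˣ)ⁿ` given by an integer matrix. -/
def hom {m n : ℕ} (M : Matrix (Fin m) (Fin n) ℤ) (t : Fin m → ℂˣ) : Fin n → ℂˣ :=
  fun k => ∏ j, t j ^ M j k

end Torus

/-! ### The groups `(G_i, B_i, T_i)` -/

/-- A triple `(G, B, T)` obtained from the standard triple `(SL(2, ℂ), upper triangular, diagonal)`
by enlarging the diagonal torus `T_α` to a torus `T ≃ (ℂˣ)ⁿ`: `G` is the product of its subgroups
`SL(2, ℂ)` (via `ι`) and `T` (via `τ`), which intersect exactly in `T_α`, and `T` normalizes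
`SL(2, ℂ)`. That `G` is algebraic means that the inclusion `T_α ⊆ T` is an algebraic homomorphism
(so given by an integral vector, the coroot `H_α`) and that `T` acts on `SL(2, ℂ)` by algebraic
automorphisms; these are trivial on `T_α` because `T` is commutative, so the action is
`SL2.twist` by an algebraic character of `T`, the root `α`. The Borel subgroup is
`B = T N`, where `N` consists of the `ι (SL2.upper x)`. -/
structure P1Triple (n : ℕ) where
  G : Type
  [group : Group G]
  ι : SL2.Grp →* G
  τ : (Fin n → ℂˣ) →* G
  coroot : Fin n → ℤ
  root : Fin n → ℤ
  ι_injective : Function.Injective ι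
  τ_injective : Function.Injective τ
  ι_diag : ∀ x : ℂˣ, ι (SL2.diag x) = τ (fun k => x ^ coroot k)
  conj : ∀ (t : Fin n → ℂˣ) (g : SL2.Grp),
    τ t * ι g * (τ t)⁻¹ = ι (SL2.twist (Torus.char root t) g)
  inter : ∀ (g : SL2.Grp) (t : Fin n → ℂˣ), ι g = τ t → ∃ x : ℂˣ, g = SL2.diag x
  surj : ∀ x : G, ∃ (g : SL2.Grp) (t : Fin n → ℂˣ), x = ι g * τ t

namespace P1Triple

variable {n : ℕ} (P : P1Triple n)

instance : Group P.G := P.group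

/-- The representative `s` of the reflection in `G`. -/
def s : P.G := P.ι SL2.refl

/-- The integer `⟨μ, H_α⟩`. -/
def level (μ : Fin n → ℤ) : ℤ := ∑ k, μ k * P.coroot k

/-- The reflected weight `s μ = μ - ⟨μ, H_α⟩ α`. -/
def reflect (μ : Fin n → ℤ) : Fin n → ℤ := fun k => μ k - P.level μ * P.root k

/-- The reflection on the real Lie algebra of `T`: `s A = A - α(A) H_α`. -/
def reflectLie (A : Fin n → ℝ) : Fin n → ℝ :=
  fun k => A k - (∑ m, (P.root m : ℝ) * A m) * P.coroot k

/-- The element `τ(t) exp(x E_α)` of `B = T N`; every element of `B` is uniquely of this form. -/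
def borel (t : Fin n → ℂˣ) (x : ℂ) : P.G := P.τ t * P.ι (SL2.upper x)

/-- The compact real form `U = SU(2) · U(1)ⁿ` of `G`. -/
def compactForm : Set P.G :=
  {u | ∃ (a : SL2.Grp) (t : Fin n → ℂˣ),
    (a : Matrix (Fin 2) (Fin 2) ℂ) ∈ Matrix.unitaryGroup (Fin 2) ℂ ∧
    (∀ k, ‖(t k : ℂ)‖ = 1) ∧ u = P.ι a * P.τ t}

open Classical in
/-- The component `c(g)` in `T` of an element `g` of the open set `N⁻ T N`
(and `1` outside of this set). -/
noncomputable def cartan (g : P.G) : Fin n → ℂˣ :=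
  if h : ∃ (t : Fin n → ℂˣ) (z x : ℂ),
      g = P.ι (SL2.lower z) * P.τ t * P.ι (SL2.upper x)
    then Classical.choose h else 1

/-- The decomposition `G = U B`. -/
lemma exists_iwasawa (g : P.G) : ∃ u ∈ P.compactForm, ∃ (t : Fin n → ℂˣ) (x : ℂ),
    g = u * P.borel t x := by
  obtain ⟨a, t, rfl⟩ := P.surj g
  obtain ⟨k, r, x, hk, rfl⟩ := SL2.exists_iwasawa a
  have hup : P.ι (SL2.upper x) * P.τ t =
      P.τ t * P.ι (SL2.upper ((((Torus.char P.root t)⁻¹ : ℂˣ) : ℂ) * x)) := by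
    have h := P.conj t (SL2.upper ((((Torus.char P.root t)⁻¹ : ℂˣ) : ℂ) * x))
    have he : SL2.twist (Torus.char P.root t)
        (SL2.upper ((((Torus.char P.root t)⁻¹ : ℂˣ) : ℂ) * x)) = SL2.upper x := by
      apply Subtype.ext
      simp [SL2.twist, SL2.upper]
    rw [he, mul_inv_eq_iff_eq_mul] at h
    exact h.symm
  refine ⟨P.ι k, ⟨k, 1, hk, by simp, by simp⟩, (fun m => r ^ P.coroot m) * t,
    (((Torus.char P.root t)⁻¹ : ℂˣ) : ℂ) * x, ?_⟩
  rw [borel, map_mul P.τ, ← P.ι_diag, map_mul, map_mul, mul_assoc (P.ι k * P.ι (SL2.diag r)), hup]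
  simp only [mul_assoc]

end P1Triple

/-! ### Chains -/

/-- The data of a toric `ℙ¹`-chain of length `ℓ`: triples `(G_i, B_i, T_i)` and connecting
homomorphisms `T_{i+1} → T_i`, given by integer matrices. The indices run through
`0, …, ℓ - 1` instead of `1, …, ℓ`. -/
structure P1Chain (ℓ : ℕ) where
  rank : Fin ℓ → ℕ
  triple : ∀ i, P1Triple (rank i)
  γ : ∀ (i : Fin ℓ) (h : i.val + 1 < ℓ), Matrix (Fin (rank ⟨i.val + 1, h⟩)) (Fin (rank i)) ℤ

namespace P1Chain

variable {ℓ : ℕ} (C : P1Chain ℓ)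

/-- The product group `G_s`. -/
abbrev G : Type := ∀ i, (C.triple i).G

/-- The product torus `T_s`. -/
abbrev T : Type := ∀ i, Fin (C.rank i) → ℂˣ

/-- The real Lie algebra of the positive part of `T_s`. -/
abbrev LieT : Type := ∀ i, Fin (C.rank i) → ℝ

/-- Weights of `T_s`. -/
abbrev Weight : Type := ∀ i, Fin (C.rank i) → ℤ

/-- The embedding of `T_s` in `G_s`. -/
def torus (h : C.T) : C.G := fun i => (C.triple i).τ (h i)

/-- The value `h ^ μ` of a weight of `T_s`. -/
def char (μ : C.Weight) (h : C.T) : ℂˣ := ∏ i, Torus.char (μ i) (h i)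

/-- The exponential `e^y` of an element of the complex Lie algebra of `T_s`. -/
noncomputable def exp (y : ∀ i, Fin (C.rank i) → ℂ) : C.T := fun i => Torus.exp (y i)

/-- The image in `T_i` of the `T_{i+1}`-component of `t`, and `1` if `i` is the last index. -/
def connect (t : C.T) (i : Fin ℓ) : Fin (C.rank i) → ℂˣ :=
  if h : i.val + 1 < ℓ then Torus.hom (C.γ i h) (t ⟨i.val + 1, h⟩) else 1

/-- The right action of `B_s` on `G_s`:
`(g · b)_i = γ(b_{i+1})⁻¹ g_i b_i`, where `b_i = τ(t_i) exp(x_i E_i)`; the connecting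
homomorphisms are trivial on the unipotent parts. The chain is the quotient `𝒳 = G_s / B_s`. -/
def act (g : C.G) (t : C.T) (x : Fin ℓ → ℂ) : C.G :=
  fun i => ((C.triple i).τ (C.connect t i))⁻¹ * g i * (C.triple i).borel (t i) (x i)

/-! ### The line bundle and its holomorphic sections -/

variable (lam : C.Weight)

/-- The weight `s λ = (s_i λ_i)`. -/
def reflect : C.Weight := fun i => (C.triple i).reflect (lam i)

/-- The character `b ↦ b^λ̃` of `B_s` that defines `ℒ_λ`, where `λ̃_i` is `λ_i` minus the pull-back
of `s_{i-1} λ_{i-1}` to `T_i`. It depends on the torus component `t` of `b` only. -/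
def tildeChar (t : C.T) : ℂˣ :=
  ∏ i, Torus.char (lam i) (t i) * (Torus.char (C.reflect lam i) (C.connect t i))⁻¹

/-- Holomorphic functions on the complex Lie group `G_s`, tested in the local charts
`(z, y, x) ↦ (g_i exp(z_i E_{-α_i}) τ(e^{y_i}) exp(x_i E_{α_i}))_i`
around the points `g` of `G_s`. -/
def IsHolomorphic (f : C.G → ℂ) : Prop :=
  ∀ g : C.G, Differentiable ℂ
    (fun p : (Fin ℓ → ℂ) × (∀ i, Fin (C.rank i) → ℂ) × (Fin ℓ → ℂ) =>
      f (fun i => g i * (C.triple i).ι (SL2.lower (p.1 i)) *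
        (C.triple i).τ (Torus.exp (p.2.1 i)) * (C.triple i).ι (SL2.upper (p.2.2 i))))

/-- The space `ℋ` of global holomorphic sections of `ℒ_λ`: the holomorphic functions `f` on `G_s`
with `f(g · b) = f(g) b^λ̃`. -/
def sections : Submodule ℂ (C.G → ℂ) where
  carrier := {f | C.IsHolomorphic f ∧
    ∀ g t x, f (C.act g t x) = f g * (C.tildeChar lam t : ℂ)}
  zero_mem' := ⟨fun _ => differentiable_const 0, fun _ _ _ => by simp⟩
  add_mem' := by
    rintro a b ⟨ha, ha'⟩ ⟨hb, hb'⟩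
    refine ⟨fun g => (ha g).add (hb g), fun g t x => ?_⟩
    simp only [Pi.add_apply, ha', hb', add_mul]
  smul_mem' := by
    rintro r a ⟨ha, ha'⟩
    refine ⟨fun g => (ha g).const_smul r, fun g t x => ?_⟩
    simp only [Pi.smul_apply, ha', smul_eq_mul, mul_assoc]

lemma torus_mul_act (h : C.T) (g : C.G) (t : C.T) (x : Fin ℓ → ℂ) :
    C.torus h * C.act g t x = C.act (C.torus h * g) t x := by
  funext i
  have hc : (C.triple i).τ (h i) * ((C.triple i).τ (C.connect t i))⁻¹ =
      ((C.triple i).τ (C.connect t i))⁻¹ * (C.triple i).τ (h i) := by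
    rw [← map_inv, ← map_mul, ← map_mul, mul_comm]
  simp only [Pi.mul_apply, torus, act, ← mul_assoc, hc]

/-- Pull-back of sections by `h ∈ T_s`: `f ↦ h^{-sλ} f(h ·)`. The factor normalizes the lift of the
action of `T_s` on `𝒳` to `ℒ_λ` in such a way that the meromorphic section `c^λ` is invariant, i.e.
`φ c^λ ↦ (φ ∘ h) c^λ` for meromorphic functions `φ` on `𝒳`; so only the image of `h` in the
torus of transformations of `𝒳` matters. -/
noncomputable def pullback (h : C.T) : C.sections lam →ₗ[ℂ] C.sections lam where
  toFun f := ⟨fun g => ((C.char (C.reflect lam) h)⁻¹ : ℂˣ) * f.1 (C.torus h * g), by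
    refine ⟨fun g => ?_, fun g t x => ?_⟩
    · have := f.2.1 (C.torus h * g)
      simp only [Pi.mul_apply, mul_assoc] at this ⊢
      exact this.const_mul _
    · simp only [C.torus_mul_act, f.2.2, mul_assoc]⟩
  map_add' f f' := by
    ext g
    simp [mul_add]
  map_smul' r f := by
    ext g
    simp [mul_left_comm]

/-- The representation `(U_h f)(ξ) = f(h⁻¹ ξ)` of the torus on `ℋ`. -/
noncomputable def rep (h : C.T) : C.sections lam →ₗ[ℂ] C.sections lam := C.pullback lam h⁻¹

/-! ### Affine coordinates and the weight set -/

/-- The point `(exp(z_i E_{α_i}) s_i)_i`, which represents the point of `𝒳` with affine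
coordinates `z`. -/
def affinePoint (z : Fin ℓ → ℂ) : C.G :=
  fun i => (C.triple i).ι (SL2.upper (z i)) * (C.triple i).s

/-- The section `c^λ(g) = ∏ c(s_i g_i)^{λ_i}`, on the open set of the `g` with all
`s_i g_i ∈ N⁻ T N`, which contains all `affinePoint z`. -/
noncomputable def cSection (g : C.G) : ℂ :=
  ∏ i, (Torus.char (lam i) ((C.triple i).cartan ((C.triple i).s * g i)) : ℂ)

/-- The weight set: the `η ∈ ℤ^ℓ` for which `f_η = z^η c^λ` extends to a global holomorphic
section of `ℒ_λ`. -/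
def weightSet : Set (Fin ℓ → ℤ) :=
  {η | ∃ f ∈ C.sections lam, ∀ z : Fin ℓ → ℂ, (∀ i, z i ≠ 0) →
    f (C.affinePoint z) = (∏ i, z i ^ η i) * C.cSection lam (C.affinePoint z)}

/-- For `h = e^A` one has `h · [affinePoint z] = [affinePoint (e^{ϖ_i(A)} z_i)]`, because
`h_i exp(zE)s = exp(h_i^α z E) s · (s⁻¹ h_i s)`, and the factor `s⁻¹ h_i s` is moved on to the next
group. `transport A i` is the Lie algebra element of `T_i` that arrives at `i` in this way. -/
def transport (A : C.LieT) (i : Fin ℓ) : Fin (C.rank i) → ℝ :=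
  A i + if h : i.val + 1 < ℓ then
      Matrix.vecMul ((C.triple ⟨i.val + 1, h⟩).reflectLie (transport A ⟨i.val + 1, h⟩))
        ((C.γ i h).map (Int.cast : ℤ → ℝ))
    else 0
termination_by ℓ - i.val

/-- The weight `ϖ_i` of the coordinate `z_i`, as a functional on the Lie algebra:
`z_i(e^A ξ) = e^{ϖ_i(A)} z_i(ξ)`. -/
def varpi (i : Fin ℓ) (A : C.LieT) : ℝ := ∑ k, ((C.triple i).root k : ℝ) * C.transport A i k

/-- The pairing `η(A) = ∑ n_i ϖ_i(A)` for `η = ∑ n_i ϖ_i`. -/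
def pairing (η : Fin ℓ → ℝ) (A : C.LieT) : ℝ := ∑ i, η i * C.varpi i A

/-! ### The unitary metric, its curvature, and the moment map -/

/-- The torus components of the factors `b_i` in a decomposition `g = u · b`, computed one group
at a time. -/
noncomputable def iwasawaAux (g : C.G) (i : Fin ℓ) : Fin (C.rank i) → ℂˣ :=
  (((C.triple i).exists_iwasawa ((C.triple i).τ (if h : i.val + 1 < ℓ then
    Torus.hom (C.γ i h) (iwasawaAux g ⟨i.val + 1, h⟩) else 1) * g i)).choose_spec.2).choose
termination_by ℓ - i.val

/-- Every element of `G_s` is of the form `u · b` with `u` in the compact form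
`U_s = ∏ U_i` and `b` in `B_s`. -/
lemma exists_iwasawa (g : C.G) : ∃ (t : C.T) (x : Fin ℓ → ℂ) (u : C.G),
    (∀ i, u i ∈ (C.triple i).compactForm) ∧ g = C.act u t x := by
  have key : ∀ i, ∃ (x : ℂ) (u : (C.triple i).G), u ∈ (C.triple i).compactForm ∧
      (C.triple i).τ (C.connect (C.iwasawaAux g) i) * g i =
        u * (C.triple i).borel (C.iwasawaAux g i) x := by
    intro i
    have h := (C.triple i).exists_iwasawa ((C.triple i).τ (C.connect (C.iwasawaAux g) i) * g i)
    have e : C.iwasawaAux g i = (h.choose_spec.2).choose := by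
      rw [iwasawaAux]
      rfl
    rw [e]
    exact ⟨_, _, h.choose_spec.1, h.choose_spec.2.choose_spec.choose_spec⟩
  choose x u hu hx using key
  refine ⟨C.iwasawaAux g, x, u, hu, ?_⟩
  funext i
  rw [act, mul_assoc, ← hx i, inv_mul_cancel_left]

/-- The norm of the element of the line `ℒ_λ(ξ)` at the point `ξ` represented by `g`, given by the
value `v`. An element of the line bundle is a class of pairs `(g, v)` under
`(g, v) ~ (g · b, v b^λ̃)`, and the norm of the class of `(u, v)` is `|v|` if `u ∈ U_s`; thus
a section `f` has norm `|f(ξ)| = |f(u)|` at the point represented by `u ∈ U_s`. -/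
noncomputable def fiberNorm (g : C.G) (v : ℂ) : ℝ :=
  ‖v‖ / ‖(C.tildeChar lam (C.exists_iwasawa g).choose : ℂ)‖

/-- Positivity of the curvature form `σ_λ = -(1/2πi) ∂̄∂ log |f|²` of `ℒ_λ` at every point of `𝒳`.
Around the point represented by `g` there are the local coordinates `z ↦ (g_i exp(z_i E_{-α_i}))_i`
and the local holomorphic section `f` which is `1` on these representatives, so
`σ_λ = (1/2πi) ∑ K_ij dz̄_i ∧ dz_j` with `K = -log |f|²` and `K_ij = ∂²K/∂z̄_i∂z_j`.
The form is positive if the matrix `K_ij` is positive definite; and for a direction `v`,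
`4 ∑ K_ij v̄_i v_j` is the Laplacian at `0` of the function `w ↦ K(w v)` on `ℂ`. -/
def IsPositive : Prop :=
  ∀ (g : C.G) (v : Fin ℓ → ℂ), v ≠ 0 →
    0 < Laplacian.laplacian (fun w : ℂ =>
      - Real.log (C.fiberNorm lam
        (fun i => g i * (C.triple i).ι (SL2.lower (w * v i))) 1 ^ 2)) (0 : ℂ)

/-- The moment map: its value at the point represented by `g` is the functional `momentMap lam g` on
the Lie algebra. On the domain of the coordinates `z_i = e^{τ_i + i φ_i}`, it is
`A ↦ ½ d/dt K(e^{tA} ξ) = ∑ J_i ϖ_i(A)`, `J_i = ½ ∂K/∂τ_i`, for the potential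
`K = -log |c^λ|²`. As `e^A` maps `c^λ(ξ)` to `c^λ(e^A ξ)`, this is
`A ↦ -½ d/dt log |e^{tA} p|²` for the element `p = c^λ(ξ)` of the line at `ξ`, or equivalently for
any non-zero `p` in this line, which makes sense on all of `𝒳`. -/
noncomputable def momentMap (g : C.G) (A : C.LieT) : ℝ :=
  -(1 / 2) * deriv (fun t : ℝ =>
    Real.log (C.fiberNorm lam (C.torus (C.exp fun i k => ((t * A i k : ℝ) : ℂ)) * g)
      (C.char (C.reflect lam) (C.exp fun i k => ((t * A i k : ℝ) : ℂ))) ^ 2)) 0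

/-- The moment polytope `π(𝒳)`: the image of the moment map, in terms of the coordinates
`(J_i)` with respect to the basis `(ϖ_i)`. -/
def momentPolytope : Set (Fin ℓ → ℝ) :=
  {J | ∃ g : C.G, ∀ A : C.LieT, C.momentMap lam g A = C.pairing J A}

/-- The element `e^{iH}` of the compact torus. -/
noncomputable def expI (H : C.LieT) : C.T := C.exp fun i k => I * (H i k : ℂ)

end P1Chain

/-!
The proof compares three sets of exponents with the polytope of the `n` with `0 ≤ n_i ≤ cap_i(n)`,
where `cap_i` is affine in `n_0, …, n_{i-1}`: it is `⟨λ_i + δ_i, H_i⟩` for the weight `δ_i` of `T_i`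
(`drift`) which the preceding exponents produce through the connecting homomorphisms. The drift of
weights along the chain is dual to the transport of Lie algebra elements in the opposite direction
(`sum_covector_mul_eq`, `sum_mul_rootLie_eq`), and this identifies `∑ n_i ϖ_i` as a weight of `T_s`.

*Sections.* The affine cell is dense, so a section is determined by an entire function `F` of the
affine coordinates. Every element of `G_s` is equivalent under `B_s` to one whose components lie in
the closed unit discs of the two affine charts of `ℙ¹`. There a section is bounded by compactness,
and the modulus of the factor `b^λ̃` is found by a recursion along the chain
(`log_norm_tildeChar_of_eq_act`). The result is a bound for `F` by the exponential of a piecewise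
linear function (`exists_norm_le`). It is of polynomial growth, so `F` is a polynomial, and Cauchy's
estimate on suitable tori, together with the duality, leaves the exponents in the polytope only
(`mem_latticePolytope_of_le`). Conversely, for an integral point `n` of the polytope a product of
monomials in the first columns of the components is a global section which extends `z ^ n c^λ` up to
a constant (`monomialSection_mem`). These sections form a basis of `ℋ` that consists of eigenvectors
of the torus with the weights `∑ n_i ϖ_i`; the trace formula follows.

*The moment map.* The same recursion, for the Iwasawa decomposition instead of the discs, gives the
potential of the unitary metric. By differentiation and duality, the moment map has coordinates with
`J_i = p_i cap_i(J)`, where `p` is the vector of relative heights of the components on the spheres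
`ℙ¹` and runs through the whole unit cube (`momentMap_eq`). At the `2 ^ ℓ` fixed points of the torus
the potential in the direction of a coordinate is `cap_i(J) log (1 + |w|²)`, so positivity of the
curvature gives `cap_i(J) > 0` at the vertices `p ∈ {0, 1} ^ ℓ` of the cube. Since `J` is affine in
each `p_k`, the same holds on the whole cube, and hence the moment polytope is defined by the
inequalities `0 ≤ J_i ≤ cap_i(J)` (`mem_momentPolytope_iff`). Without positivity the two sets may
differ: the points with `J_i = p_i cap_i(J)` need not satisfy these inequalities.
-/

/-! ### Tori, `SL(2, ℂ)`, and monomials in the first column -/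

namespace Torus

lemma prod_zpow_eq_zpow_sum {ι : Type*} (s : Finset ι) (x : ℂˣ) (e : ι → ℤ) :
    ∏ k ∈ s, x ^ e k = x ^ ∑ k ∈ s, e k := by
  classical
  induction s using Finset.induction_on with
  | empty => simp
  | insert a s ha ih => rw [Finset.prod_insert ha, Finset.sum_insert ha, zpow_add, ih]

variable {n : ℕ}

lemma char_mul (μ : Fin n → ℤ) (s t : Fin n → ℂˣ) : char μ (s * t) = char μ s * char μ t := by
  simp [char, mul_zpow, Finset.prod_mul_distrib]

lemma char_one (μ : Fin n → ℤ) : char μ 1 = 1 := by simp [char]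

lemma char_inv (μ : Fin n → ℤ) (t : Fin n → ℂˣ) : char μ t⁻¹ = (char μ t)⁻¹ := by
  simp [char]

lemma char_add (μ ν : Fin n → ℤ) (t : Fin n → ℂˣ) : char (μ + ν) t = char μ t * char ν t := by
  simp [char, zpow_add, Finset.prod_mul_distrib]

lemma char_pow (μ ν : Fin n → ℤ) (x : ℂˣ) :
    char μ (fun k => x ^ ν k) = x ^ ∑ k, μ k * ν k := by
  simp only [char, ← zpow_mul]
  rw [← prod_zpow_eq_zpow_sum]
  exact Finset.prod_congr rfl fun k _ => by rw [mul_comm]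

/-- The character given by an integer vector, pulled back along the homomorphism given by an
integer matrix. -/
lemma char_hom {m : ℕ} (M : Matrix (Fin m) (Fin n) ℤ) (μ : Fin n → ℤ) (t : Fin m → ℂˣ) :
    char μ (hom M t) = char (M.mulVec μ) t := by
  simp only [char, hom, Matrix.mulVec, dotProduct, ← Finset.prod_zpow, ← zpow_mul]
  rw [Finset.prod_comm]
  exact Finset.prod_congr rfl fun j _ => prod_zpow_eq_zpow_sum _ _ _

/-- The logarithms of the moduli of the components, i.e. the projection of the torus to the Lie
algebra of its positive part. -/
noncomputable def logNorm (t : Fin n → ℂˣ) : Fin n → ℝ := fun k => Real.log ‖(t k : ℂ)‖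

lemma logNorm_mul (s t : Fin n → ℂˣ) : logNorm (s * t) = logNorm s + logNorm t := by
  funext k
  simp [logNorm, Real.log_mul]

lemma logNorm_one : logNorm (1 : Fin n → ℂˣ) = 0 := by
  funext k
  simp [logNorm]

lemma logNorm_of_norm_eq_one {t : Fin n → ℂˣ} (h : ∀ k, ‖(t k : ℂ)‖ = 1) : logNorm t = 0 := by
  funext k
  simp [logNorm, h k]

lemma logNorm_pow (x : ℂˣ) (μ : Fin n → ℤ) :
    logNorm (fun k => x ^ μ k) = fun k => Real.log ‖(x : ℂ)‖ * μ k := by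
  funext k
  simp [logNorm, Real.log_zpow, mul_comm]

lemma logNorm_exp_ofReal (y : Fin n → ℝ) : logNorm (exp fun k => (y k : ℂ)) = y := by
  funext k
  simp [logNorm, exp, Complex.norm_exp]

lemma log_norm_char (μ : Fin n → ℤ) (t : Fin n → ℂˣ) :
    Real.log ‖(char μ t : ℂ)‖ = ∑ k, (μ k : ℝ) * logNorm t k := by
  rw [char, Units.coe_prod, norm_prod, Real.log_prod (fun k _ => by simp [zpow_ne_zero])]
  simp [logNorm, Real.log_zpow]

lemma logNorm_hom {m : ℕ} (M : Matrix (Fin m) (Fin n) ℤ) (t : Fin m → ℂˣ) :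
    logNorm (hom M t) = Matrix.vecMul (logNorm t) (M.map (Int.cast : ℤ → ℝ)) := by
  funext k
  simp only [logNorm, hom, Units.coe_prod, norm_prod]
  rw [Real.log_prod (fun k _ => by simp [zpow_ne_zero])]
  simp [Matrix.vecMul, dotProduct, Real.log_zpow, logNorm, mul_comm]

lemma coe_char_exp (μ : Fin n → ℤ) (y : Fin n → ℂ) :
    (char μ (exp y) : ℂ) = Complex.exp (∑ k, (μ k : ℂ) * y k) := by
  rw [Complex.exp_sum, char, Units.coe_prod]
  exact Finset.prod_congr rfl fun k _ => by simp [exp, Complex.exp_int_mul]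

end Torus

namespace SL2

lemma mul_apply (a b : Grp) (i j : Fin 2) : (a * b) i j = a i 0 * b 0 j + a i 1 * b 1 j := by
  rw [Matrix.SpecialLinearGroup.coe_mul, Matrix.mul_apply, Fin.sum_univ_two]

lemma twist_apply_zero_zero (x : ℂˣ) (a : Grp) : twist x a 0 0 = a 0 0 := rfl

lemma twist_apply_one_zero (x : ℂˣ) (a : Grp) :
    twist x a 1 0 = ((x⁻¹ : ℂˣ) : ℂ) * a 1 0 := rfl

lemma mul_diag_apply_zero (a : Grp) (x : ℂˣ) (i : Fin 2) : (a * diag x) i 0 = a i 0 * x := by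
  rw [mul_apply]
  simp [diag]

lemma mul_upper_apply_zero (a : Grp) (x : ℂ) (i : Fin 2) : (a * upper x) i 0 = a i 0 := by
  rw [mul_apply]
  simp [upper]

lemma mul_lower_apply_zero (a : Grp) (z : ℂ) (i : Fin 2) :
    (a * lower z) i 0 = a i 0 + a i 1 * z := by
  rw [mul_apply]
  simp [lower]

lemma refl_mul_apply_zero (a : Grp) : (refl * a) 0 0 = a 1 0 ∧ (refl * a) 1 0 = -a 0 0 := by
  constructor <;>
  · rw [mul_apply]
    simp [refl]

lemma twist_upper (x : ℂˣ) (z : ℂ) : twist x (upper z) = upper (x * z) := by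
  apply Subtype.ext
  simp [twist, upper]

lemma twist_lower (x : ℂˣ) (z : ℂ) : twist x (lower z) = lower (((x⁻¹ : ℂˣ) : ℂ) * z) := by
  apply Subtype.ext
  simp [twist, lower]

lemma upper_mul_refl (z : ℂ) : upper z * refl = refl * lower (-z) := by
  apply Matrix.SpecialLinearGroup.ext
  intro i j
  rw [mul_apply, mul_apply]
  fin_cases i <;> fin_cases j <;> simp [upper, lower, refl]

/-- The decomposition of an element of the open cell `N⁻ T N`. -/
lemma eq_lower_mul_diag_mul_upper (a : Grp) (h : a 0 0 ≠ 0) :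
    a = lower (a 1 0 / a 0 0) * diag (Units.mk0 _ h) * upper (a 0 1 / a 0 0) := by
  have hdet := a.det_coe
  rw [Matrix.det_fin_two] at hdet
  apply Matrix.SpecialLinearGroup.ext
  intro i j
  rw [mul_apply, mul_apply, mul_apply]
  fin_cases i <;> fin_cases j <;> simp [upper, lower, diag] <;> field_simp
  linear_combination hdet

/-- The decomposition of an element of the open cell `N s B`. -/
lemma eq_upper_mul_refl_mul (a : Grp) (h : a 1 0 ≠ 0) :
    ∃ (y : ℂˣ) (x : ℂ), a = upper (a 0 0 / a 1 0) * refl * diag y * upper x := by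
  refine ⟨Units.mk0 (-a 1 0) (neg_ne_zero.2 h), a 1 1 / a 1 0, ?_⟩
  have hdet := a.det_coe
  rw [Matrix.det_fin_two] at hdet
  apply Matrix.SpecialLinearGroup.ext
  intro i j
  simp only [mul_apply]
  fin_cases i <;> fin_cases j <;> simp [upper, refl, diag] <;> field_simp
  linear_combination -hdet

end SL2

namespace P1Triple

variable {n : ℕ} (P : P1Triple n)

lemma ι_mul_diag (a : SL2.Grp) (y : ℂˣ) :
    P.ι (a * SL2.diag y) = P.ι a * P.τ (fun k => y ^ P.coroot k) := by
  rw [map_mul, P.ι_diag]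

lemma τ_mul_ι (t : Fin n → ℂˣ) (a : SL2.Grp) :
    P.τ t * P.ι a = P.ι (SL2.twist (Torus.char P.root t) a) * P.τ t := by
  rw [← P.conj, inv_mul_cancel_right]

lemma τ_mul_upper (t : Fin n → ℂˣ) (x : ℂ) :
    P.τ t * P.ι (SL2.upper x) = P.ι (SL2.upper (Torus.char P.root t * x)) * P.τ t := by
  rw [τ_mul_ι, SL2.twist_upper]

/-- The expression of an element of `G` as a product of elements of `SL(2, ℂ)` and `T` is unique up
to the diagonal torus of `SL(2, ℂ)`. -/
lemma exists_diag_of_ι_mul_τ_eq {a b : SL2.Grp} {s t : Fin n → ℂˣ}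
    (h : P.ι a * P.τ s = P.ι b * P.τ t) :
    ∃ y : ℂˣ, b = a * SL2.diag y ∧ s = (fun k => y ^ P.coroot k) * t := by
  have h1 : P.ι (a⁻¹ * b) = P.τ (s * t⁻¹) := by
    rw [map_mul, map_inv, map_mul, map_inv, inv_mul_eq_iff_eq_mul, ← mul_assoc, h,
      mul_inv_cancel_right]
  obtain ⟨y, hy⟩ := P.inter _ _ h1
  refine ⟨y, by rw [← hy, mul_inv_cancel_left], ?_⟩
  rw [hy, P.ι_diag] at h1
  rw [P.τ_injective h1, inv_mul_cancel_right]

/-- The root takes the value `2` on the coroot. -/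
lemma sum_root_mul_coroot : ∑ k, P.root k * P.coroot k = 2 := by
  have h := P.τ_mul_upper (fun k => (Units.mk0 (2 : ℂ) two_ne_zero) ^ P.coroot k) 1
  rw [← P.ι_diag, ← map_mul, ← map_mul, Torus.char_pow] at h
  have h1 := congrArg (fun a : SL2.Grp => a 0 1) (P.ι_injective h)
  rw [SL2.mul_apply, SL2.mul_apply] at h1
  simp [SL2.diag, SL2.upper] at h1
  have h2 : (2 : ℂ) ^ (∑ k, P.root k * P.coroot k) = 2 ^ (2 : ℤ) := by
    field_simp at h1
    rw [← h1]
    norm_num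
  have h3 : (2 : ℝ) ^ (∑ k, P.root k * P.coroot k) = 2 ^ (2 : ℤ) := by
    have := congrArg Norm.norm h2
    simpa only [norm_zpow, Complex.norm_ofNat] using this
  exact zpow_right_injective₀ (by norm_num) (by norm_num) h3

/-- The function `ι(a) τ(t) ↦ a₀₀ ^ p a₁₀ ^ q t ^ μ` on `G`. It is evaluated on a chosen
decomposition, on which it does not depend if `p + q = ⟨μ, H_α⟩`. -/
noncomputable def columnMonomial (μ : Fin n → ℤ) (p q : ℕ) (g : P.G) : ℂ :=
  (P.surj g).choose 0 0 ^ p * (P.surj g).choose 1 0 ^ q *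
    (Torus.char μ (P.surj g).choose_spec.choose : ℂ)

variable {P} {μ : Fin n → ℤ} {p q : ℕ}

lemma columnMonomial_ι_mul_τ (hμ : (p + q : ℤ) = P.level μ) (a : SL2.Grp) (t : Fin n → ℂˣ) :
    P.columnMonomial μ p q (P.ι a * P.τ t) = a 0 0 ^ p * a 1 0 ^ q * (Torus.char μ t : ℂ) := by
  obtain ⟨y, hy, hs⟩ := P.exists_diag_of_ι_mul_τ_eq (P.surj (P.ι a * P.τ t)).choose_spec.choose_spec
  have e : P.columnMonomial μ p q (P.ι a * P.τ t) = (a * SL2.diag y) 0 0 ^ p *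
      (a * SL2.diag y) 1 0 ^ q *
        (Torus.char μ (P.surj (P.ι a * P.τ t)).choose_spec.choose : ℂ) := by
    rw [← hy]
    rfl
  rw [e]
  conv_rhs => rw [hs]
  simp only [level] at hμ
  rw [Torus.char_mul, Torus.char_pow, ← hμ]
  simp only [SL2.mul_diag_apply_zero, Units.val_mul, Units.val_zpow_eq_zpow_val, zpow_add₀ y.ne_zero,
    zpow_natCast, mul_pow]
  ring

lemma columnMonomial_τ_mul (hμ : (p + q : ℤ) = P.level μ) (h : Fin n → ℂˣ) (g : P.G) :
    P.columnMonomial μ p q (P.τ h * g) =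
      (Torus.char (fun k => μ k - q * P.root k) h : ℂ) * P.columnMonomial μ p q g := by
  obtain ⟨a, t, rfl⟩ := P.surj g
  rw [← mul_assoc, τ_mul_ι, mul_assoc, ← map_mul, columnMonomial_ι_mul_τ hμ,
    columnMonomial_ι_mul_τ hμ, Torus.char_mul, SL2.twist_apply_zero_zero, SL2.twist_apply_one_zero,
    mul_pow]
  have h1 : Torus.char μ h =
      Torus.char (fun k => μ k - q * P.root k) h * Torus.char P.root h ^ q := by
    simp only [Torus.char]
    rw [← Finset.prod_pow, ← Finset.prod_mul_distrib]
    refine Finset.prod_congr rfl fun k _ => ?_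
    rw [← zpow_natCast, ← zpow_mul, ← zpow_add]
    ring_nf
  rw [h1]
  push_cast
  have h2 : ((Torus.char P.root h : ℂ)⁻¹) ^ q * (Torus.char P.root h : ℂ) ^ q = 1 := by
    rw [← mul_pow, inv_mul_cancel₀ (Units.ne_zero _), one_pow]
  linear_combination (a 0 0 ^ p * a 1 0 ^ q *
    (Torus.char (fun k => μ k - q * P.root k) h : ℂ) * (Torus.char μ t : ℂ)) * h2

lemma columnMonomial_mul_τ (hμ : (p + q : ℤ) = P.level μ) (g : P.G) (t : Fin n → ℂˣ) :
    P.columnMonomial μ p q (g * P.τ t) = P.columnMonomial μ p q g * (Torus.char μ t : ℂ) := by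
  obtain ⟨a, s, rfl⟩ := P.surj g
  rw [mul_assoc, ← map_mul, columnMonomial_ι_mul_τ hμ, columnMonomial_ι_mul_τ hμ, Torus.char_mul]
  push_cast
  ring

lemma columnMonomial_mul_upper (hμ : (p + q : ℤ) = P.level μ) (g : P.G) (x : ℂ) :
    P.columnMonomial μ p q (g * P.ι (SL2.upper x)) = P.columnMonomial μ p q g := by
  obtain ⟨a, s, rfl⟩ := P.surj g
  rw [mul_assoc, τ_mul_upper, ← mul_assoc, ← map_mul, columnMonomial_ι_mul_τ hμ,
    columnMonomial_ι_mul_τ hμ, SL2.mul_upper_apply_zero, SL2.mul_upper_apply_zero]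

lemma columnMonomial_mul_borel (hμ : (p + q : ℤ) = P.level μ) (g : P.G) (t : Fin n → ℂˣ)
    (x : ℂ) :
    P.columnMonomial μ p q (g * P.borel t x) = P.columnMonomial μ p q g * (Torus.char μ t : ℂ) := by
  rw [borel, ← mul_assoc, columnMonomial_mul_upper hμ, columnMonomial_mul_τ hμ]

lemma columnMonomial_mul_lower (hμ : (p + q : ℤ) = P.level μ) (a : SL2.Grp) (t : Fin n → ℂˣ)
    (z : ℂ) :
    P.columnMonomial μ p q (P.ι a * P.τ t * P.ι (SL2.lower z)) =
      (a 0 0 + a 0 1 * (((Torus.char P.root t)⁻¹ : ℂˣ) * z)) ^ p *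
      (a 1 0 + a 1 1 * (((Torus.char P.root t)⁻¹ : ℂˣ) * z)) ^ q * (Torus.char μ t : ℂ) := by
  rw [mul_assoc, τ_mul_ι, SL2.twist_lower, ← mul_assoc, ← map_mul, columnMonomial_ι_mul_τ hμ,
    SL2.mul_lower_apply_zero, SL2.mul_lower_apply_zero]

/-- The component in `T` of an element of `N⁻ T N` is unique. -/
lemma cartan_eq (z : ℂ) (t : Fin n → ℂˣ) (x : ℂ) :
    P.cartan (P.ι (SL2.lower z) * P.τ t * P.ι (SL2.upper x)) = t := by
  have h : ∃ (t' : Fin n → ℂˣ) (z' x' : ℂ), P.ι (SL2.lower z) * P.τ t * P.ι (SL2.upper x) =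
      P.ι (SL2.lower z') * P.τ t' * P.ι (SL2.upper x') := ⟨t, z, x, rfl⟩
  rw [cartan, dif_pos h]
  suffices key : ∀ t' : Fin n → ℂˣ, (∃ z' x' : ℂ,
      P.ι (SL2.lower z) * P.τ t * P.ι (SL2.upper x) =
        P.ι (SL2.lower z') * P.τ t' * P.ι (SL2.upper x')) → t' = t from key _ h.choose_spec
  rintro t' ⟨z', x', h'⟩
  rw [mul_assoc, τ_mul_upper, mul_assoc, τ_mul_upper, ← mul_assoc, ← mul_assoc, ← map_mul,
    ← map_mul] at h'
  obtain ⟨y, hy, ht⟩ := P.exists_diag_of_ι_mul_τ_eq h'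
  have h0 := congrArg (fun a : SL2.Grp => a 0 0) hy
  simp only [SL2.mul_diag_apply_zero, SL2.mul_upper_apply_zero] at h0
  simp [SL2.lower] at h0
  have hy1 : y = 1 := Units.ext h0.symm
  refine Eq.trans ?_ ht.symm
  funext k
  simp [hy1]

/-- The component in `T` of a point of the form `s exp(z E_α) s`. -/
lemma cartan_s_mul_upper_mul_s (z : ℂ) :
    P.cartan (P.s * (P.ι (SL2.upper z) * P.s)) = fun k => (-1 : ℂˣ) ^ P.coroot k := by
  have h : SL2.refl * (SL2.upper z * SL2.refl) =
      SL2.lower (-z) * SL2.diag (-1) * SL2.upper 0 := by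
    apply Matrix.SpecialLinearGroup.ext
    intro i j
    simp only [SL2.mul_apply]
    fin_cases i <;> fin_cases j <;> simp [SL2.upper, SL2.lower, SL2.refl, SL2.diag]
  rw [s, ← map_mul, ← map_mul, h, map_mul, map_mul, P.ι_diag, cartan_eq]

end P1Triple

/-! ### Drift of weights and transport of Lie algebra elements -/

namespace P1Triple

variable {n : ℕ} (P : P1Triple n)

/-- The differential of the root. -/
def rootLie (X : Fin n → ℝ) : ℝ := ∑ k, (P.root k : ℝ) * X k

lemma reflectLie_apply (X : Fin n → ℝ) (k : Fin n) :
    P.reflectLie X k = X k - P.rootLie X * P.coroot k := rfl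

/-- The weight `s δ + c α`, with coefficients in any ring. -/
def reflectAdd {R : Type*} [CommRing R] (δ : Fin n → R) (c : R) : Fin n → R :=
  fun k => δ k - (∑ m, δ m * P.coroot m) * P.root k + c * P.root k

lemma sum_reflectAdd_mul (δ : Fin n → ℝ) (c : ℝ) (X : Fin n → ℝ) :
    ∑ k, P.reflectAdd δ c k * X k = ∑ k, δ k * P.reflectLie X k + c * P.rootLie X := by
  simp only [reflectAdd, reflectLie, rootLie, mul_sub, sub_mul, add_mul, Finset.sum_sub_distrib,
    Finset.sum_add_distrib, Finset.mul_sum, mul_assoc, Finset.sum_mul]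
  congr 2
  rw [Finset.sum_comm]
  exact Finset.sum_congr rfl fun _ _ => Finset.sum_congr rfl fun _ _ => by ring

lemma rootLie_coroot : P.rootLie (fun k => (P.coroot k : ℝ)) = 2 := by
  rw [rootLie]
  exact_mod_cast P.sum_root_mul_coroot

end P1Triple

namespace P1Chain

variable {ℓ : ℕ} (C : P1Chain ℓ)

/-- Induction from the last index downwards. -/
lemma downward_induction {p : Fin ℓ → Prop}
    (h : ∀ i, (∀ hi : i.val + 1 < ℓ, p ⟨i.val + 1, hi⟩) → p i) (i : Fin ℓ) : p i :=
  h i fun _ => downward_induction h _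
termination_by ℓ - i.val

/-- The differential of `connect`. -/
def lieConnect (X : C.LieT) : C.LieT := fun i =>
  if h : i.val + 1 < ℓ then
    Matrix.vecMul (X ⟨i.val + 1, h⟩) ((C.γ i h).map (Int.cast : ℤ → ℝ)) else 0

lemma logNorm_connect (t : C.T) (i : Fin ℓ) :
    Torus.logNorm (C.connect t i) = C.lieConnect (fun j => Torus.logNorm (t j)) i := by
  rw [connect, lieConnect]
  split_ifs with h
  · exact Torus.logNorm_hom _ _
  · exact Torus.logNorm_one

lemma transport_eq (A : C.LieT) (i : Fin ℓ) :
    C.transport A i =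
      A i + C.lieConnect (fun j => (C.triple j).reflectLie (C.transport A j)) i := by
  rw [transport]
  rfl

variable {R : Type*} [CommRing R]

/-- The correction of the weight `λ_i` which is caused by the exponents `n_0, …, n_{i-1}`: it is
`0` for the first index, and its value at `i + 1` is the pull-back under the connecting
homomorphism of `s_i δ + n_i α_i`, if `δ` is its value at `i`. -/
def driftAux (n : Fin ℓ → R) : (i : ℕ) → (hi : i < ℓ) → Fin (C.rank ⟨i, hi⟩) → R
  | 0, _ => 0
  | i + 1, hi => ((C.γ ⟨i, i.lt_succ_self.trans hi⟩ hi).map (Int.cast : ℤ → R)).mulVec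
      ((C.triple ⟨i, i.lt_succ_self.trans hi⟩).reflectAdd
        (driftAux n i (i.lt_succ_self.trans hi)) (n ⟨i, i.lt_succ_self.trans hi⟩))

/-- See `driftAux`. -/
def drift (n : Fin ℓ → R) (i : Fin ℓ) : Fin (C.rank i) → R := C.driftAux n i.1 i.2

/-- The weight `s_i δ + n_i α_i`, where `δ` is the drift at `i`. By duality, `∑ n_i ϖ_i` is the
weight of `T_s` with these components. -/
def covector (n : Fin ℓ → R) (i : Fin ℓ) : Fin (C.rank i) → R :=
  (C.triple i).reflectAdd (C.drift n i) (n i)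

lemma drift_zero (n : Fin ℓ → R) (hi : 0 < ℓ) : C.drift n ⟨0, hi⟩ = 0 := rfl

lemma drift_succ (n : Fin ℓ → R) (i : ℕ) (hi : i + 1 < ℓ) :
    C.drift n ⟨i + 1, hi⟩ =
      ((C.γ ⟨i, i.lt_succ_self.trans hi⟩ hi).map (Int.cast : ℤ → R)).mulVec
        (C.covector n ⟨i, i.lt_succ_self.trans hi⟩) := rfl

/-- The integer or real number `⟨λ_i + δ_i, H_i⟩` for the drift `δ` of `n`: the upper bound for the
`i`-th coordinate in the moment polytope, as a function of the preceding coordinates. -/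
def cap (lam : C.Weight) (n : Fin ℓ → R) (i : Fin ℓ) : R :=
  ((C.triple i).level (lam i) : R) + ∑ k, C.drift n i k * (C.triple i).coroot k

/-- The integral points `n` with `0 ≤ n_i ≤ cap n i`. -/
def latticePolytope (lam : C.Weight) : Set (Fin ℓ → ℤ) :=
  {n | ∀ i, 0 ≤ n i ∧ n i ≤ C.cap lam n i}

lemma intCast_drift (n : Fin ℓ → ℤ) (i : Fin ℓ) (k : Fin (C.rank i)) :
    ((C.drift n i k : ℤ) : R) = C.drift (fun j => (n j : R)) i k := by
  obtain ⟨i, hi⟩ := i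
  induction i with
  | zero => simp [drift_zero]
  | succ i ih =>
    simp only [drift_succ, Matrix.mulVec, dotProduct, covector, P1Triple.reflectAdd]
    push_cast
    simp only [ih, Matrix.map_apply, Int.cast_id]

lemma intCast_covector (n : Fin ℓ → ℤ) (i : Fin ℓ) (k : Fin (C.rank i)) :
    ((C.covector n i k : ℤ) : R) = C.covector (fun j => (n j : R)) i k := by
  simp only [covector, P1Triple.reflectAdd]
  push_cast
  simp only [intCast_drift]

lemma intCast_cap (lam : C.Weight) (n : Fin ℓ → ℤ) (i : Fin ℓ) :
    ((C.cap lam n i : ℤ) : R) = C.cap lam (fun j => (n j : R)) i := by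
  simp only [cap]
  push_cast
  simp only [intCast_drift]

/-- The drift at `i` depends on the coordinates with indices less than `i` only. -/
lemma drift_congr {n n' : Fin ℓ → R} {i : Fin ℓ} (h : ∀ j < i, n j = n' j) :
    C.drift n i = C.drift n' i := by
  obtain ⟨i, hi⟩ := i
  induction i with
  | zero => rfl
  | succ i ih =>
    rw [drift_succ, drift_succ, covector, covector,
      ih _ fun j hj => h j (hj.trans (by simp [Fin.lt_def])), h _ (by simp [Fin.lt_def])]

lemma cap_congr (lam : C.Weight) {n n' : Fin ℓ → R} {i : Fin ℓ} (h : ∀ j < i, n j = n' j) :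
    C.cap lam n i = C.cap lam n' i := by
  rw [cap, cap, C.drift_congr h]

lemma drift_combination (a b : R) (n n' : Fin ℓ → R) (i : Fin ℓ) :
    C.drift (fun j => a * n j + b * n' j) i = a • C.drift n i + b • C.drift n' i := by
  obtain ⟨i, hi⟩ := i
  induction i with
  | zero => simp [drift_zero]
  | succ i ih =>
    rw [drift_succ, drift_succ, drift_succ, ← Matrix.mulVec_smul, ← Matrix.mulVec_smul,
      ← Matrix.mulVec_add]
    congr 1
    funext k
    simp only [covector, P1Triple.reflectAdd, ih, Pi.add_apply, Pi.smul_apply, smul_eq_mul,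
      add_mul, Finset.sum_add_distrib, mul_assoc, ← Finset.mul_sum]
    ring

lemma cap_combination (lam : C.Weight) {a b : R} (hab : a + b = 1) (n n' : Fin ℓ → R)
    (i : Fin ℓ) :
    C.cap lam (fun j => a * n j + b * n' j) i = a * C.cap lam n i + b * C.cap lam n' i := by
  simp only [cap, drift_combination, Pi.add_apply, Pi.smul_apply, smul_eq_mul, add_mul,
    Finset.sum_add_distrib, mul_assoc, ← Finset.mul_sum]
  linear_combination (-((C.triple i).level (lam i) : R)) * hab

/-- The drift is obtained from the covector by the transpose of `lieConnect`. -/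
lemma sum_drift_mul (J : Fin ℓ → ℝ) (X : C.LieT) :
    ∑ i, ∑ k, C.drift J i k * X i k = ∑ i, ∑ k, C.covector J i k * C.lieConnect X i k := by
  cases ℓ with
  | zero => simp
  | succ m =>
    rw [Fin.sum_univ_succ, Fin.sum_univ_castSucc]
    have h0 : ∑ k, C.drift J 0 k * X 0 k = 0 :=
      Finset.sum_eq_zero fun k _ => by
        rw [show C.drift J 0 = 0 from C.drift_zero J m.succ_pos]
        simp
    have h1 : ∑ k, C.covector J (Fin.last m) k * C.lieConnect X (Fin.last m) k = 0 :=
      Finset.sum_eq_zero fun k _ => by simp [lieConnect]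
    rw [h0, h1, zero_add, add_zero]
    refine Finset.sum_congr rfl fun i _ => ?_
    have h2 : C.lieConnect X i.castSucc = Matrix.vecMul (X i.succ)
        ((C.γ i.castSucc (by simp)).map (Int.cast : ℤ → ℝ)) := by
      rw [lieConnect, dif_pos (by simp)]
      rfl
    rw [h2]
    change (C.drift J i.succ) ⬝ᵥ (X i.succ) = (C.covector J i.castSucc) ⬝ᵥ _
    rw [dotProduct_comm (C.covector J i.castSucc), ← Matrix.dotProduct_mulVec, dotProduct_comm]
    rfl

/-- The multiplicative version of `sum_drift_mul`. -/
lemma prod_char_drift (n : Fin ℓ → ℤ) (t : C.T) :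
    ∏ i, Torus.char (C.drift n i) (t i) = ∏ i, Torus.char (C.covector n i) (C.connect t i) := by
  cases ℓ with
  | zero => simp
  | succ m =>
    rw [Fin.prod_univ_succ, Fin.prod_univ_castSucc]
    have h0 : Torus.char (C.drift n 0) (t 0) = 1 := by
      rw [show C.drift n 0 = 0 from C.drift_zero n m.succ_pos]
      simp [Torus.char]
    have h1 : Torus.char (C.covector n (Fin.last m)) (C.connect t (Fin.last m)) = 1 := by
      rw [connect, dif_neg (by simp), Torus.char_one]
    rw [h0, h1, one_mul, mul_one]
    refine Finset.prod_congr rfl fun i _ => ?_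
    have h2 : C.connect t i.castSucc = Torus.hom (C.γ i.castSucc (by simp)) (t i.succ) := by
      rw [connect, dif_pos (by simp)]
      rfl
    rw [h2, Torus.char_hom]
    have h3 : (C.γ i.castSucc (by simp)).map (Int.cast : ℤ → ℤ) = C.γ i.castSucc (by simp) := by
      ext
      simp
    change Torus.char (((C.γ i.castSucc (by simp)).map (Int.cast : ℤ → ℤ)).mulVec
      (C.covector n i.castSucc)) (t i.succ) = _
    rw [h3]

/-- The transport of Lie algebra elements along the chain is dual to the drift of weights. -/
lemma sum_covector_mul_eq {B E : C.LieT} (J : Fin ℓ → ℝ)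
    (h : ∀ i, E i = B i + C.lieConnect (fun j => (C.triple j).reflectLie (E j)) i) :
    ∑ i, ∑ k, C.covector J i k * B i k = ∑ i, J i * (C.triple i).rootLie (E i) := by
  have h1 := C.sum_drift_mul J (fun j => (C.triple j).reflectLie (E j))
  have h2 : ∀ i, ∑ k, C.covector J i k * E i k = ∑ k, C.covector J i k * B i k +
      ∑ k, C.covector J i k * C.lieConnect (fun j => (C.triple j).reflectLie (E j)) i k := by
    intro i
    rw [← Finset.sum_add_distrib]
    refine Finset.sum_congr rfl fun k _ => ?_
    rw [← mul_add]
    exact congrArg _ (congrFun (h i) k)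
  have h3 : ∑ i, ∑ k, C.covector J i k * E i k = ∑ i, (∑ k, C.covector J i k * B i k +
      ∑ k, C.covector J i k * C.lieConnect (fun j => (C.triple j).reflectLie (E j)) i k) :=
    Finset.sum_congr rfl fun i _ => h2 i
  simp only [covector, P1Triple.sum_reflectAdd_mul, Finset.sum_add_distrib] at h3 h1 ⊢
  linarith

lemma sum_covector_mul (J : Fin ℓ → ℝ) (A : C.LieT) :
    ∑ i, ∑ k, C.covector J i k * A i k = C.pairing J A :=
  C.sum_covector_mul_eq J (C.transport_eq A)

/-- The duality for a transport to which the multiple `q_i H_i` of the coroot is added at each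
step. -/
lemma sum_mul_rootLie_eq {A X : C.LieT} {q : Fin ℓ → ℝ} (J : Fin ℓ → ℝ)
    (h : ∀ i, X i = A i + C.lieConnect (fun j k => (C.triple j).reflectLie (X j) k +
      (C.triple j).coroot k * q j) i) :
    ∑ i, J i * (C.triple i).rootLie (X i) = C.pairing J A +
      ∑ i, q i * ∑ k, C.drift J i k * (C.triple i).coroot k := by
  set Q : C.LieT := fun i k => (C.triple i).coroot k * q i with hQ
  have hr : ∀ i, (C.triple i).rootLie (Q i) = 2 * q i := by
    intro i
    rw [← (C.triple i).rootLie_coroot, P1Triple.rootLie, P1Triple.rootLie, Finset.sum_mul]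
    simp only [hQ, mul_assoc]
  have hs : ∀ i, (C.triple i).rootLie ((X - Q) i) =
      (C.triple i).rootLie (X i) - 2 * q i := by
    intro i
    rw [← hr]
    simp only [P1Triple.rootLie, Pi.sub_apply, mul_sub, Finset.sum_sub_distrib]
  have h1 := C.sum_covector_mul_eq (B := A - Q) (E := X - Q) J (fun i => by
    rw [Pi.sub_apply, h i, Pi.sub_apply, add_sub_right_comm]
    congr 2
    funext j k
    rw [P1Triple.reflectLie_apply, P1Triple.reflectLie_apply, hs]
    simp only [Pi.sub_apply, hQ]
    ring)
  have h2 : ∑ i, ∑ k, C.covector J i k * (A - Q) i k =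
      C.pairing J A - ∑ i, ∑ k, C.covector J i k * Q i k := by
    rw [← sum_covector_mul, ← Finset.sum_sub_distrib]
    simp only [Pi.sub_apply, mul_sub, Finset.sum_sub_distrib]
  have h3 : ∀ i, ∑ k, C.covector J i k * Q i k =
      -(q i * ∑ k, C.drift J i k * (C.triple i).coroot k) + J i * (2 * q i) := by
    intro i
    rw [covector, P1Triple.sum_reflectAdd_mul, hr, Finset.mul_sum, ← Finset.sum_neg_distrib]
    congr 1
    refine Finset.sum_congr rfl fun k _ => ?_
    rw [P1Triple.reflectLie_apply, hr]
    simp only [hQ]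
    ring
  simp only [h2, h3, hs, mul_sub, Finset.sum_add_distrib, Finset.sum_sub_distrib,
    Finset.sum_neg_distrib] at h1
  linarith

end P1Chain

/-! ### Normal forms and monomial sections -/

lemma Torus.exp_zero {n : ℕ} : Torus.exp (0 : Fin n → ℂ) = 1 := by
  funext k
  ext
  simp [Torus.exp]

lemma SL2.upper_zero : SL2.upper 0 = 1 := by
  apply Matrix.SpecialLinearGroup.ext
  intro i j
  fin_cases i <;> fin_cases j <;> simp [SL2.upper]

lemma SL2.lower_zero : SL2.lower 0 = 1 := by
  apply Matrix.SpecialLinearGroup.ext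
  intro i j
  fin_cases i <;> fin_cases j <;> simp [SL2.lower]

namespace P1Triple

variable {n : ℕ} (P : P1Triple n)

lemma differentiable_columnMonomial {μ : Fin n → ℤ} {p q : ℕ} (hμ : (p + q : ℤ) = P.level μ)
    (g : P.G) : Differentiable ℂ (fun v : ℂ × (Fin n → ℂ) × ℂ => P.columnMonomial μ p q
      (g * P.ι (SL2.lower v.1) * P.τ (Torus.exp v.2.1) * P.ι (SL2.upper v.2.2))) := by
  obtain ⟨a, t, rfl⟩ := P.surj g
  simp only [columnMonomial_mul_upper hμ, columnMonomial_mul_τ hμ, columnMonomial_mul_lower hμ,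
    Torus.coe_char_exp]
  fun_prop

lemma ι_mul_diag_mul_upper_mul_τ (a : SL2.Grp) (y : ℂˣ) (x : ℂ) (t : Fin n → ℂˣ) :
    P.ι (a * SL2.diag y * SL2.upper x) * P.τ t =
      P.ι a * P.borel ((fun k => y ^ P.coroot k) * t)
        (((Torus.char P.root t)⁻¹ : ℂˣ) * x) := by
  have h : P.ι (SL2.upper x) * P.τ t =
      P.τ t * P.ι (SL2.upper (((Torus.char P.root t)⁻¹ : ℂˣ) * x)) := by
    rw [τ_mul_upper, ← mul_assoc, Units.mul_inv, one_mul]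
  rw [borel, map_mul, ι_mul_diag, mul_assoc, h, map_mul]
  simp only [mul_assoc]

end P1Triple

namespace P1Chain

variable {ℓ : ℕ} (C : P1Chain ℓ)

/-- The solution of a system of equations `t_i = F_i (connect t i)`. -/
def solveConnect (F : ∀ i, (Fin (C.rank i) → ℂˣ) → (Fin (C.rank i) → ℂˣ)) (i : Fin ℓ) :
    Fin (C.rank i) → ℂˣ :=
  F i (if h : i.val + 1 < ℓ then Torus.hom (C.γ i h) (solveConnect F ⟨i.val + 1, h⟩) else 1)
termination_by ℓ - i.val

lemma solveConnect_eq (F : ∀ i, (Fin (C.rank i) → ℂˣ) → (Fin (C.rank i) → ℂˣ)) (i : Fin ℓ) :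
    C.solveConnect F i = F i (C.connect (C.solveConnect F) i) := by
  rw [solveConnect]
  rfl

/-- A normal form for the elements of the groups `G_i` under the right action of `B_i` gives a
normal form for the elements of `G_s` under the right action of `B_s`. -/
lemma exists_eq_act {g : C.G} (S : ∀ i, Set (C.triple i).G)
    (h : ∀ i (t' : Fin (C.rank i) → ℂˣ), ∃ v ∈ S i, ∃ (t : Fin (C.rank i) → ℂˣ) (x : ℂ),
      (C.triple i).τ t' * g i = v * (C.triple i).borel t x) :
    ∃ (t : C.T) (x : Fin ℓ → ℂ) (v : C.G), (∀ i, v i ∈ S i) ∧ g = C.act v t x := by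
  choose v hv t x hx using h
  refine ⟨C.solveConnect t, fun i => x i (C.connect (C.solveConnect t) i),
    fun i => v i (C.connect (C.solveConnect t) i), fun i => hv _ _, ?_⟩
  funext i
  rw [act, mul_assoc]
  conv_rhs => rw [C.solveConnect_eq t i]
  rw [← hx, inv_mul_cancel_left]

lemma act_eq_iff {g v : C.G} {t : C.T} {x : Fin ℓ → ℂ} :
    g = C.act v t x ↔ ∀ i, (C.triple i).τ (C.connect t i) * g i =
      v i * (C.triple i).borel (t i) (x i) := by
  simp only [funext_iff, act, mul_assoc, eq_inv_mul_iff_mul_eq]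

lemma affinePoint_eq (z : Fin ℓ → ℂ) (i : Fin ℓ) :
    C.affinePoint z i = (C.triple i).ι (SL2.upper (z i) * SL2.refl) * (C.triple i).τ 1 := by
  rw [map_one, mul_one, map_mul]
  rfl

variable (lam : C.Weight)

lemma differentiable_affinePoint {f : C.G → ℂ} (hf : C.IsHolomorphic f) :
    Differentiable ℂ (fun z => f (C.affinePoint z)) := by
  have h : Differentiable ℂ (fun z : Fin ℓ → ℂ => f (fun i => (C.triple i).s *
      (C.triple i).ι (SL2.lower ((-z) i)) *
      (C.triple i).τ (Torus.exp ((0 : ∀ i, Fin (C.rank i) → ℂ) i)) *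
      (C.triple i).ι (SL2.upper ((0 : Fin ℓ → ℂ) i)))) :=
    Differentiable.comp (hf (fun i => (C.triple i).s))
      (f := fun z : Fin ℓ → ℂ => (-z, 0, 0)) (by fun_prop)
  simp only [Pi.zero_apply, Torus.exp_zero, SL2.upper_zero, Pi.neg_apply, map_one, mul_one] at h
  have he : ∀ z : Fin ℓ → ℂ, C.affinePoint z =
      fun i => (C.triple i).s * (C.triple i).ι (SL2.lower (-z i)) := by
    intro z
    funext i
    rw [affinePoint, P1Triple.s, ← map_mul, ← map_mul, SL2.upper_mul_refl]
  simpa only [he] using h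

/-- The orbits of the points with affine coordinates contain all `g` with components in the open
cells `N_i s_i B_i`. -/
lemma exists_eq_act_affinePoint {a : Fin ℓ → SL2.Grp} (ha : ∀ i, a i 1 0 ≠ 0) (t' : C.T) :
    ∃ (t : C.T) (x z : Fin ℓ → ℂ),
      (fun i => (C.triple i).ι (a i) * (C.triple i).τ (t' i)) = C.act (C.affinePoint z) t x := by
  obtain ⟨t, x, v, hv, h⟩ := C.exists_eq_act
    (g := fun i => (C.triple i).ι (a i) * (C.triple i).τ (t' i))
    (fun i => Set.range fun z => (C.triple i).ι (SL2.upper z) * (C.triple i).s) (by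
      intro i h
      have h0 : SL2.twist (Torus.char (C.triple i).root h) (a i) 1 0 ≠ 0 := by
        rw [SL2.twist_apply_one_zero]
        exact mul_ne_zero (Units.ne_zero _) (ha i)
      obtain ⟨y, x, hy⟩ := SL2.eq_upper_mul_refl_mul _ h0
      refine ⟨_, ⟨SL2.twist (Torus.char (C.triple i).root h) (a i) 0 0 /
        SL2.twist (Torus.char (C.triple i).root h) (a i) 1 0, rfl⟩,
        (fun k => y ^ (C.triple i).coroot k) * (h * t' i),
        ((Torus.char (C.triple i).root (h * t' i))⁻¹ : ℂˣ) * x, ?_⟩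
      rw [← mul_assoc, P1Triple.τ_mul_ι, mul_assoc, ← map_mul]
      conv_lhs => rw [hy]
      rw [P1Triple.ι_mul_diag_mul_upper_mul_τ, map_mul]
      rfl)
  choose z hz using hv
  refine ⟨t, x, z, ?_⟩
  rw [h]
  congr 1
  funext i
  exact (hz i).symm

/-- A holomorphic section is determined by its restriction to the domain of the affine coordinates:
this domain is dense. -/
lemma eq_zero_of_affinePoint {f : C.G → ℂ} (hf : f ∈ C.sections lam)
    (h : ∀ z, f (C.affinePoint z) = 0) : f = 0 := by
  funext g
  choose a t ha using fun i => (C.triple i).surj (g i)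
  have hg : g = fun i => (C.triple i).ι (a i) * (C.triple i).τ (t i) := funext ha
  set u : Fin ℓ → ℂ := fun i => ((Torus.char (C.triple i).root (t i))⁻¹ : ℂˣ) with hu
  have hu0 : ∀ i, u i ≠ 0 := fun i => Units.ne_zero _
  -- Along a line through `g` the components leave the complement of the cells at once.
  have hev : ∀ᶠ w : ℂ in nhdsWithin 0 {0}ᶜ, ∀ i, a i 1 0 + a i 1 1 * (u i * w) ≠ 0 := by
    rw [Filter.eventually_all]
    intro i
    by_cases h0 : a i 1 0 = 0
    · have h1 : a i 1 1 ≠ 0 := by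
        intro h1
        have hdet := (a i).det_coe
        rw [Matrix.det_fin_two, h0, h1] at hdet
        simp at hdet
      filter_upwards [self_mem_nhdsWithin] with w hw
      rw [h0, zero_add]
      exact mul_ne_zero h1 (mul_ne_zero (hu0 i) hw)
    · apply Filter.Eventually.filter_mono nhdsWithin_le_nhds
      have hc : Continuous (fun w : ℂ => a i 1 0 + a i 1 1 * (u i * w)) := by fun_prop
      exact hc.continuousAt.eventually_ne (by simpa using h0)
  set φ : ℂ → ℂ := fun w => f (fun i => g i * (C.triple i).ι (SL2.lower w) *
    (C.triple i).τ (Torus.exp 0) * (C.triple i).ι (SL2.upper 0)) with hφ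
  have hcont : Continuous φ :=
    (hf.1 g).continuous.comp (f := fun w : ℂ => ((fun _ => w), 0, 0)) (by fun_prop)
  have hφ0 : ∀ᶠ w in nhdsWithin (0 : ℂ) {0}ᶜ, φ w = 0 := by
    filter_upwards [hev] with w hw
    obtain ⟨t₁, x₁, z₁, hz⟩ := C.exists_eq_act_affinePoint (a := fun i => a i * SL2.lower (u i * w))
      (fun i => by simpa [SL2.mul_lower_apply_zero] using hw i) t
    have he : (fun i => g i * (C.triple i).ι (SL2.lower w) *
        (C.triple i).τ (Torus.exp 0) * (C.triple i).ι (SL2.upper 0)) =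
        C.act (C.affinePoint z₁) t₁ x₁ := by
      rw [← hz, hg]
      funext i
      rw [Torus.exp_zero, SL2.upper_zero, map_one, map_one, mul_one, mul_one, mul_assoc,
        P1Triple.τ_mul_ι, ← mul_assoc, SL2.twist_lower, map_mul]
    simp only [hφ]
    rw [he, hf.2, h, zero_mul]
  have hlim : Filter.Tendsto φ (nhdsWithin (0 : ℂ) {0}ᶜ) (nhds (φ 0)) :=
    hcont.continuousAt.mono_left nhdsWithin_le_nhds
  have h4 : φ 0 = 0 :=
    tendsto_nhds_unique hlim (tendsto_const_nhds.congr' (hφ0.mono fun _ h => h.symm))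
  simpa [hφ, Torus.exp_zero, SL2.upper_zero, SL2.lower_zero] using h4

/-- The function on `G_s` which is the section extending `z ^ n c^λ`, up to a sign. -/
noncomputable def monomialSection (n : Fin ℓ → ℤ) (g : C.G) : ℂ :=
  ∏ i, (C.triple i).columnMonomial (lam i + C.drift n i) (n i).toNat (C.cap lam n i - n i).toNat
    (g i)

variable {lam} {n : Fin ℓ → ℤ}

lemma toNat_add_toNat_eq_level (hn : n ∈ C.latticePolytope lam) (i : Fin ℓ) :
    ((n i).toNat + (C.cap lam n i - n i).toNat : ℤ) =
      (C.triple i).level (lam i + C.drift n i) := by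
  have h := hn i
  rw [Int.toNat_of_nonneg h.1, Int.toNat_of_nonneg (by linarith [h.2]), add_sub_cancel, cap]
  simp [P1Triple.level, add_mul, Finset.sum_add_distrib]

lemma reflect_add_covector (hn : n ∈ C.latticePolytope lam) (i : Fin ℓ) :
    (fun k => (lam i + C.drift n i) k -
      (C.cap lam n i - n i).toNat * (C.triple i).root k) = C.reflect lam i + C.covector n i := by
  funext k
  rw [Int.toNat_of_nonneg (by linarith [(hn i).2])]
  simp only [Pi.add_apply, reflect, P1Triple.reflect, covector, P1Triple.reflectAdd, cap,
    Int.cast_id]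
  ring

lemma monomialSection_mem (hn : n ∈ C.latticePolytope lam) :
    C.monomialSection lam n ∈ C.sections lam := by
  have hμ := C.toNat_add_toNat_eq_level hn
  refine ⟨fun g => ?_, fun g t x => ?_⟩
  · simp only [monomialSection]
    have hd : ∀ i, Differentiable ℂ
        (fun p : (Fin ℓ → ℂ) × (∀ i, Fin (C.rank i) → ℂ) × (Fin ℓ → ℂ) =>
          (C.triple i).columnMonomial (lam i + C.drift n i) (n i).toNat
            (C.cap lam n i - n i).toNat (g i * (C.triple i).ι (SL2.lower (p.1 i)) *
              (C.triple i).τ (Torus.exp (p.2.1 i)) * (C.triple i).ι (SL2.upper (p.2.2 i)))) := by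
      intro i
      exact Differentiable.comp ((C.triple i).differentiable_columnMonomial (hμ i) (g i))
        (f := fun p : (Fin ℓ → ℂ) × (∀ i, Fin (C.rank i) → ℂ) × (Fin ℓ → ℂ) =>
          (p.1 i, p.2.1 i, p.2.2 i)) (by fun_prop)
    exact fun p => (HasFDerivAt.finsetProd fun i _ => (hd i p).hasFDerivAt).differentiableAt
  · have h1 : C.tildeChar lam t = ∏ i, (Torus.char (C.reflect lam i + C.covector n i)
        (C.connect t i))⁻¹ * Torus.char (lam i + C.drift n i) (t i) := by
      have h2 := C.prod_char_drift n t
      simp only [tildeChar, Torus.char_add, mul_inv, Finset.prod_mul_distrib, h2,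
        Finset.prod_inv_distrib]
      rw [mul_mul_mul_comm, inv_mul_cancel, mul_one, mul_comm]
    have h2 : ∀ i, (C.triple i).columnMonomial (lam i + C.drift n i) (n i).toNat
        (C.cap lam n i - n i).toNat (C.act g t x i) =
        (C.triple i).columnMonomial (lam i + C.drift n i) (n i).toNat
          (C.cap lam n i - n i).toNat (g i) * (((Torus.char (C.reflect lam i + C.covector n i)
        (C.connect t i))⁻¹ * Torus.char (lam i + C.drift n i) (t i) : ℂˣ) : ℂ) := by
      intro i
      rw [act, P1Triple.columnMonomial_mul_borel (hμ i), ← map_inv,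
        P1Triple.columnMonomial_τ_mul (hμ i), C.reflect_add_covector hn, Torus.char_inv,
        Units.val_mul]
      ring
    simp only [monomialSection, h2, h1, Units.coe_prod, ← Finset.prod_mul_distrib]

lemma monomialSection_torus_mul (hn : n ∈ C.latticePolytope lam) (h : C.T) (g : C.G) :
    C.monomialSection lam n (C.torus h * g) =
      (C.char (C.reflect lam) h : ℂ) * (∏ i, (Torus.char (C.covector n i) (h i) : ℂ)) *
        C.monomialSection lam n g := by
  simp only [monomialSection, char, Units.coe_prod, ← Finset.prod_mul_distrib]
  refine Finset.prod_congr rfl fun i _ => ?_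
  rw [Pi.mul_apply, torus, P1Triple.columnMonomial_τ_mul (C.toNat_add_toNat_eq_level hn i),
    C.reflect_add_covector hn, Torus.char_add, Units.val_mul]

/-- The monomial sections are eigenvectors of the torus. -/
lemma pullback_monomialSection (hn : n ∈ C.latticePolytope lam) (h : C.T) :
    C.pullback lam h ⟨C.monomialSection lam n, C.monomialSection_mem hn⟩ =
      ((∏ i, Torus.char (C.covector n i) (h i) : ℂˣ) : ℂ) •
        (⟨C.monomialSection lam n, C.monomialSection_mem hn⟩ : C.sections lam) := by
  ext g
  change ((C.char (C.reflect lam) h)⁻¹ : ℂˣ) * C.monomialSection lam n (C.torus h * g) =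
    ((∏ i, Torus.char (C.covector n i) (h i) : ℂˣ) : ℂ) * C.monomialSection lam n g
  rw [C.monomialSection_torus_mul hn, Units.coe_prod, ← mul_assoc, ← mul_assoc, Units.inv_mul,
    one_mul]

/-- The eigenvalue of the monomial section with exponent `n` is the value of the weight
`∑ n_i ϖ_i`. -/
lemma prod_char_covector_expI (n : Fin ℓ → ℤ) (H : C.LieT) :
    ((∏ i, Torus.char (C.covector n i) (C.expI H i) : ℂˣ) : ℂ) =
      Complex.exp (I * (C.pairing (fun i => (n i : ℝ)) H : ℂ)) := by
  rw [← sum_covector_mul, Units.coe_prod]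
  simp only [expI, exp, Torus.coe_char_exp, ← Complex.exp_sum, ← intCast_covector]
  congr 1
  push_cast
  simp only [Finset.mul_sum]
  exact Finset.sum_congr rfl fun i _ => Finset.sum_congr rfl fun k _ => by ring

/-- The sign by which `monomialSection` differs from `z ^ n` in the affine coordinates. -/
noncomputable def monomialSign (lam : C.Weight) (n : Fin ℓ → ℤ) : ℂ :=
  ∏ i, (-1) ^ ((n i).toNat + (C.cap lam n i - n i).toNat)

lemma monomialSign_ne_zero : C.monomialSign lam n ≠ 0 :=
  Finset.prod_ne_zero_iff.2 fun _ _ => pow_ne_zero _ (by simp)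

lemma monomialSection_affinePoint (hn : n ∈ C.latticePolytope lam) (z : Fin ℓ → ℂ) :
    C.monomialSection lam n (C.affinePoint z) =
      C.monomialSign lam n * ∏ i, z i ^ (n i).toNat := by
  simp only [monomialSection, monomialSign, ← Finset.prod_mul_distrib]
  refine Finset.prod_congr rfl fun i _ => ?_
  rw [affinePoint_eq, P1Triple.columnMonomial_ι_mul_τ (C.toNat_add_toNat_eq_level hn i),
    SL2.mul_apply, SL2.mul_apply]
  simp [SL2.upper, SL2.refl, Torus.char_one]
  rw [neg_pow, pow_add]
  ring

lemma cSection_affinePoint (z : Fin ℓ → ℂ) :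
    C.cSection lam (C.affinePoint z) = ∏ i, (-1) ^ (C.triple i).level (lam i) := by
  refine Finset.prod_congr rfl fun i _ => ?_
  rw [affinePoint, P1Triple.cartan_s_mul_upper_mul_s, Torus.char_pow]
  simp [P1Triple.level]

end P1Chain

/-! ### The torus component of a factorization -/

namespace P1Triple

variable {n : ℕ} (P : P1Triple n)

lemma norm_char_root (t : Fin n → ℂˣ) :
    ‖(Torus.char P.root t : ℂ)‖ = Real.exp (P.rootLie (Torus.logNorm t)) := by
  rw [rootLie, ← Torus.log_norm_char, Real.exp_log (by simp)]

/-- Let `N` be a homogeneous function of the first columns of matrices. In a factorization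
`τ(t') g = v b` with `v` normalized by `N = 1`, the modulus of the torus component of `b` can be
expressed by `N`. -/
lemma logNorm_eq_of_factorization {N : ℂ → ℂ → ℝ} (hN : ∀ y p q, N (y * p) (y * q) = ‖y‖ * N p q)
    {a k : SL2.Grp} {t₀ t' u t : Fin n → ℂˣ} {x : ℂ}
    (h : P.τ t' * (P.ι a * P.τ t₀) = P.ι k * P.τ u * P.borel t x)
    (hk : N (k 0 0) (k 1 0) = 1) (hu : ∀ j, ‖(u j : ℂ)‖ = 1) :
    Torus.logNorm t = fun j => Torus.logNorm t₀ j + (P.reflectLie (Torus.logNorm t') j +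
      P.coroot j * Real.log (N (Torus.char P.root t' * a 0 0) (a 1 0))) := by
  rw [← mul_assoc, τ_mul_ι, mul_assoc, ← map_mul, borel, mul_assoc (P.ι k), ← mul_assoc (P.τ u),
    ← map_mul, τ_mul_upper, ← mul_assoc, ← map_mul] at h
  obtain ⟨y, hy, ht⟩ := P.exists_diag_of_ι_mul_τ_eq h
  have h0 := congrArg (fun b : SL2.Grp => b 0 0) hy
  have h1 := congrArg (fun b : SL2.Grp => b 1 0) hy
  simp only [SL2.mul_diag_apply_zero, SL2.mul_upper_apply_zero, SL2.twist_apply_zero_zero,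
    SL2.twist_apply_one_zero] at h0 h1
  have h2 : N (k 0 0) (k 1 0) = ‖(((Torus.char P.root t')⁻¹ * y : ℂˣ) : ℂ)‖ *
      N (Torus.char P.root t' * a 0 0) (a 1 0) := by
    rw [← hN, h0, h1]
    have h3 : (((Torus.char P.root t')⁻¹ : ℂˣ) : ℂ) * (Torus.char P.root t' : ℂ) = 1 :=
      Units.inv_mul _
    push_cast at h3 ⊢
    congr 1
    · linear_combination (-(a 0 0 * y)) * h3
    · ring
  rw [hk] at h2
  have h3 := congrArg Real.log h2
  have hpos : N (Torus.char P.root t' * a 0 0) (a 1 0) ≠ 0 := by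
    intro h
    rw [h, mul_zero] at h2
    exact one_ne_zero h2
  rw [Real.log_one, Real.log_mul (by simp) hpos, Units.val_mul, norm_mul,
    Real.log_mul (by simp) (by simp), Units.val_inv_eq_inv_val, norm_inv, Real.log_inv,
    norm_char_root, Real.log_exp] at h3
  have h4 := congrArg Torus.logNorm ht
  rw [Torus.logNorm_mul, Torus.logNorm_mul, Torus.logNorm_mul, Torus.logNorm_pow,
    Torus.logNorm_of_norm_eq_one hu, zero_add] at h4
  funext j
  have h5 := congrFun h4 j
  simp only [Pi.add_apply] at h5
  rw [reflectLie_apply]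
  linear_combination -h5 + (P.coroot j : ℝ) * h3

lemma sum_reflect_mul (μ : Fin n → ℤ) (X : Fin n → ℝ) :
    ∑ k, (P.reflect μ k : ℝ) * X k = ∑ k, (μ k : ℝ) * X k - P.level μ * P.rootLie X := by
  simp only [reflect, rootLie]
  push_cast
  simp only [sub_mul, Finset.sum_sub_distrib, Finset.mul_sum, mul_assoc]

lemma sum_mul_reflectLie (μ : Fin n → ℤ) (X : Fin n → ℝ) :
    ∑ k, (μ k : ℝ) * P.reflectLie X k = ∑ k, (P.reflect μ k : ℝ) * X k := by
  rw [sum_reflect_mul]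
  simp only [reflectLie_apply, mul_sub, Finset.sum_sub_distrib, level]
  push_cast
  rw [Finset.sum_mul]
  congr 1
  exact Finset.sum_congr rfl fun k _ => by ring

end P1Triple

namespace P1Chain

variable {ℓ : ℕ} (C : P1Chain ℓ)

/-- The element of the Lie algebra of `T_i` which acts on the `i`-th component, when the
torus components of the elements `b_j` are moved along the chain and `h` acts from the left. -/
noncomputable def incoming (t h : C.T) : C.LieT := fun i => Torus.logNorm (C.connect t i * h i)

section Factorization

variable {N : ℂ → ℂ → ℝ} {a k : Fin ℓ → SL2.Grp} {t₀ h u t : C.T} {x : Fin ℓ → ℂ}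

lemma logNorm_eq_of_eq_act
    (hN : ∀ y p q, N (y * p) (y * q) = ‖y‖ * N p q)
    (hg : (fun i => (C.triple i).τ (h i) * ((C.triple i).ι (a i) * (C.triple i).τ (t₀ i))) =
      C.act (fun i => (C.triple i).ι (k i) * (C.triple i).τ (u i)) t x)
    (hk : ∀ i, N (k i 0 0) (k i 1 0) = 1) (hu : ∀ i j, ‖(u i j : ℂ)‖ = 1) (i : Fin ℓ) :
    Torus.logNorm (t i) = fun j => Torus.logNorm (t₀ i) j +
      ((C.triple i).reflectLie (C.incoming t h i) j + (C.triple i).coroot j *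
        Real.log (N (Torus.char (C.triple i).root (C.connect t i * h i) * a i 0 0) (a i 1 0))) := by
  refine (C.triple i).logNorm_eq_of_factorization hN (k := k i) (u := u i) (x := x i) ?_
    (hk i) (hu i)
  have h1 := C.act_eq_iff.1 hg i
  rw [← mul_assoc, ← map_mul] at h1
  exact h1

/-- The recursion for the logarithms of the torus components in a normal form. -/
lemma incoming_eq_of_eq_act
    (hN : ∀ y p q, N (y * p) (y * q) = ‖y‖ * N p q)
    (hg : (fun i => (C.triple i).τ (h i) * ((C.triple i).ι (a i) * (C.triple i).τ (t₀ i))) =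
      C.act (fun i => (C.triple i).ι (k i) * (C.triple i).τ (u i)) t x)
    (hk : ∀ i, N (k i 0 0) (k i 1 0) = 1) (hu : ∀ i j, ‖(u i j : ℂ)‖ = 1) (i : Fin ℓ) :
    C.incoming t h i = Torus.logNorm (h i) + C.lieConnect (fun i j => Torus.logNorm (t₀ i) j +
      ((C.triple i).reflectLie (C.incoming t h i) j + (C.triple i).coroot j *
        Real.log (N (Torus.char (C.triple i).root (C.connect t i * h i) * a i 0 0)
          (a i 1 0)))) i := by
  rw [incoming, Torus.logNorm_mul, C.logNorm_connect, add_comm]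
  congr 2
  funext i
  exact C.logNorm_eq_of_eq_act hN hg hk hu i

/-- The modulus of the character `b ↦ b^λ̃` that occurs when an element of `G_s` is brought into
normal form. -/
lemma log_norm_tildeChar_of_eq_act
    (hN : ∀ y p q, N (y * p) (y * q) = ‖y‖ * N p q)
    (hg : (fun i => (C.triple i).τ (h i) * ((C.triple i).ι (a i) * (C.triple i).τ (t₀ i))) =
      C.act (fun i => (C.triple i).ι (k i) * (C.triple i).τ (u i)) t x)
    (hk : ∀ i, N (k i 0 0) (k i 1 0) = 1) (hu : ∀ i j, ‖(u i j : ℂ)‖ = 1)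
    (lam : C.Weight) :
    Real.log ‖(C.tildeChar lam t : ℂ)‖ = ∑ i, ∑ j, (lam i j : ℝ) * Torus.logNorm (t₀ i) j +
      ∑ i, ((C.triple i).level (lam i) : ℝ) *
        Real.log (N (Torus.char (C.triple i).root (C.connect t i * h i) * a i 0 0) (a i 1 0)) +
      Real.log ‖(C.char (C.reflect lam) h : ℂ)‖ := by
  rw [tildeChar, char, Units.coe_prod, Units.coe_prod, norm_prod, norm_prod,
    Real.log_prod (fun i _ => by simp), Real.log_prod (fun i _ => by simp),
    ← Finset.sum_add_distrib, ← Finset.sum_add_distrib]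
  refine Finset.sum_congr rfl fun i _ => ?_
  rw [Units.val_mul, norm_mul, Real.log_mul (by simp) (by simp), Units.val_inv_eq_inv_val, norm_inv,
    Real.log_inv, Torus.log_norm_char, Torus.log_norm_char, Torus.log_norm_char,
    C.logNorm_eq_of_eq_act hN hg hk hu i]
  simp only [mul_add, Finset.sum_add_distrib]
  rw [P1Triple.sum_mul_reflectLie]
  have h1 : C.incoming t h i = Torus.logNorm (C.connect t i) + Torus.logNorm (h i) :=
    Torus.logNorm_mul _ _
  have h2 : ∑ j, (lam i j : ℝ) * ((C.triple i).coroot j *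
      Real.log (N (Torus.char (C.triple i).root (C.connect t i * h i) * a i 0 0) (a i 1 0))) =
      ((C.triple i).level (lam i) : ℝ) *
      Real.log (N (Torus.char (C.triple i).root (C.connect t i * h i) * a i 0 0) (a i 1 0)) := by
    rw [P1Triple.level]
    push_cast
    rw [Finset.sum_mul]
    exact Finset.sum_congr rfl fun j _ => by ring
  rw [h1, h2]
  simp only [Pi.add_apply, mul_add, Finset.sum_add_distrib, reflect]
  ring

end Factorization

/-! ### The growth of sections -/

/-- Representatives of the points of the closed unit discs in the two affine charts of `ℙ¹`. -/
def discs : Set SL2.Grp :=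
  {v | ∃ z : ℂ, ‖z‖ ≤ 1 ∧ (v = SL2.lower z ∨ v = SL2.refl * SL2.lower z)}

lemma max_norm_of_mem_discs {v : SL2.Grp} (hv : v ∈ discs) : max ‖v 0 0‖ ‖v 1 0‖ = 1 := by
  obtain ⟨z, hz, rfl | rfl⟩ := hv
  · simpa [SL2.lower] using hz
  · rw [(SL2.refl_mul_apply_zero _).1, (SL2.refl_mul_apply_zero _).2]
    simpa [SL2.lower] using hz

lemma exists_mem_discs (a : SL2.Grp) :
    ∃ v ∈ discs, ∃ (y : ℂˣ) (x : ℂ), a = v * SL2.diag y * SL2.upper x := by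
  have key : ∀ b : SL2.Grp, ‖b 1 0‖ ≤ ‖b 0 0‖ →
      ∃ z : ℂ, ‖z‖ ≤ 1 ∧ ∃ (y : ℂˣ) (x : ℂ), b = SL2.lower z * SL2.diag y * SL2.upper x := by
    intro b hb
    have h0 : b 0 0 ≠ 0 := by
      intro h0
      rw [h0, norm_zero, norm_le_zero_iff] at hb
      have hdet := b.det_coe
      rw [Matrix.det_fin_two, h0, hb] at hdet
      simp at hdet
    refine ⟨_, ?_, _, _, SL2.eq_lower_mul_diag_mul_upper b h0⟩
    rw [norm_div]
    exact div_le_one_of_le₀ hb (norm_nonneg _)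
  rcases le_total ‖a 1 0‖ ‖a 0 0‖ with h | h
  · obtain ⟨z, hz, y, x, e⟩ := key a h
    exact ⟨_, ⟨z, hz, Or.inl rfl⟩, y, x, e⟩
  · have hr : SL2.refl * (SL2.refl * a) = -a := by
      apply Matrix.SpecialLinearGroup.ext
      intro i j
      simp only [SL2.mul_apply]
      fin_cases i <;> fin_cases j <;> simp [SL2.refl]
    have hd : ∀ y : ℂˣ, -SL2.diag y = SL2.diag (-y) := by
      intro y
      apply Matrix.SpecialLinearGroup.ext
      intro i j
      rw [Matrix.SpecialLinearGroup.coe_neg, Matrix.neg_apply]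
      fin_cases i <;> fin_cases j <;> simp [SL2.diag]
    obtain ⟨z, hz, y, x, e⟩ := key (SL2.refl * a) (by
      rw [(SL2.refl_mul_apply_zero _).1, (SL2.refl_mul_apply_zero _).2, norm_neg]
      exact h)
    refine ⟨_, ⟨z, hz, Or.inr rfl⟩, -y, x, ?_⟩
    rw [← hd, mul_neg, neg_mul, mul_assoc SL2.refl, mul_assoc SL2.refl, ← e, hr, neg_neg]

lemma exists_eq_act_discs (g : C.G) :
    ∃ (t : C.T) (x : Fin ℓ → ℂ) (v : Fin ℓ → SL2.Grp), (∀ i, v i ∈ discs) ∧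
      g = C.act (fun i => (C.triple i).ι (v i) * (C.triple i).τ 1) t x := by
  obtain ⟨t, x, v, hv, h⟩ := C.exists_eq_act (g := g) (fun i => (C.triple i).ι '' discs) (by
    intro i t'
    obtain ⟨a, s, hs⟩ := (C.triple i).surj (g i)
    obtain ⟨v, hv, y, x, e⟩ := exists_mem_discs (SL2.twist (Torus.char (C.triple i).root t') a)
    refine ⟨_, ⟨v, hv, rfl⟩, (fun k => y ^ (C.triple i).coroot k) * (t' * s),
      ((Torus.char (C.triple i).root (t' * s))⁻¹ : ℂˣ) * x, ?_⟩
    rw [hs, ← mul_assoc, P1Triple.τ_mul_ι, mul_assoc, ← map_mul, e,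
      P1Triple.ι_mul_diag_mul_upper_mul_τ])
  choose w hw hw' using hv
  refine ⟨t, x, w, hw, ?_⟩
  rw [h]
  congr 1
  funext i
  rw [map_one, mul_one, hw']

variable {lam : C.Weight}

/-- By compactness, a section is bounded on the representatives in discs. -/
lemma exists_norm_le_discs {f : C.G → ℂ} (hf : C.IsHolomorphic f) :
    ∃ B : ℝ, 0 < B ∧ ∀ v : Fin ℓ → SL2.Grp, (∀ i, v i ∈ discs) →
      ‖f (fun i => (C.triple i).ι (v i) * (C.triple i).τ 1)‖ ≤ B := by
  have key : ∀ e : Fin ℓ → Bool, ∃ B : ℝ, ∀ z ∈ Metric.closedBall (0 : Fin ℓ → ℂ) 1,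
      ‖f (fun i => (C.triple i).ι ((if e i then SL2.refl else 1) * SL2.lower (z i)) *
        (C.triple i).τ 1)‖ ≤ B := by
    intro e
    have h : Differentiable ℂ (fun z : Fin ℓ → ℂ => f (fun i =>
        (C.triple i).ι (if e i then SL2.refl else 1) *
        (C.triple i).ι (SL2.lower (z i)) *
        (C.triple i).τ (Torus.exp ((0 : ∀ i, Fin (C.rank i) → ℂ) i)) *
        (C.triple i).ι (SL2.upper ((0 : Fin ℓ → ℂ) i)))) :=
      Differentiable.comp (hf (fun i => (C.triple i).ι (if e i then SL2.refl else 1)))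
        (f := fun z : Fin ℓ → ℂ => (z, 0, 0)) (by fun_prop)
    simp only [Pi.zero_apply, Torus.exp_zero, SL2.upper_zero, map_one, mul_one, ← map_mul] at h ⊢
    exact (isCompact_closedBall _ _).exists_bound_of_continuousOn h.continuous.continuousOn
  choose B hB using key
  refine ⟨∑ e, |B e| + 1, by positivity, fun v hv => ?_⟩
  choose z hz hv' using hv
  choose e he using fun i => show ∃ e : Bool, v i =
      (if e then SL2.refl else 1) * SL2.lower (z i) from by
    rcases hv' i with h | h
    · exact ⟨false, by simpa using h⟩
    · exact ⟨true, by simpa using h⟩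
  simp only [he]
  calc _ ≤ B e := hB e z (by simpa [pi_norm_le_iff_of_nonneg] using hz)
    _ ≤ |B e| := le_abs_self _
    _ ≤ ∑ e, |B e| := Finset.single_le_sum (f := fun e => |B e|) (fun _ _ => abs_nonneg _)
        (Finset.mem_univ e)
    _ ≤ _ := by linarith

/-- The piecewise linear data at the point with affine coordinates `z`, from which the growth of
sections is computed: `X_i` is the element of the Lie algebra of `T_i` that arrives at the `i`-th
component, and `Q_i = log max(|z'_i|, 1)` for the coordinate `z'_i = e^{α_i(X_i)} z_i`. -/
structure IsGrowth (z : Fin ℓ → ℂ) (X : C.LieT) (Q : Fin ℓ → ℝ) : Prop where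
  incoming : ∀ i, X i = C.lieConnect (fun j k => (C.triple j).reflectLie (X j) k +
    (C.triple j).coroot k * Q j) i
  height : ∀ i, Q i = Real.log (max (Real.exp ((C.triple i).rootLie (X i)) * ‖z i‖) 1)

lemma exists_norm_le {f : C.G → ℂ} (hf : f ∈ C.sections lam) :
    ∃ B : ℝ, 0 < B ∧ ∀ z, ∃ X Q, C.IsGrowth z X Q ∧ ‖f (C.affinePoint z)‖ ≤
      B * Real.exp (∑ i, ((C.triple i).level (lam i) : ℝ) * Q i) := by
  obtain ⟨B, hB0, hB⟩ := C.exists_norm_le_discs hf.1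
  refine ⟨B, hB0, fun z => ?_⟩
  obtain ⟨t, x, v, hv, h⟩ := C.exists_eq_act_discs (C.affinePoint z)
  have hN : ∀ y p q : ℂ, max ‖y * p‖ ‖y * q‖ = ‖y‖ * max ‖p‖ ‖q‖ := by
    intro y p q
    rw [norm_mul, norm_mul, mul_max_of_nonneg _ _ (norm_nonneg _)]
  have h' : (fun i => (C.triple i).τ ((1 : C.T) i) *
      ((C.triple i).ι (SL2.upper (z i) * SL2.refl) * (C.triple i).τ ((1 : C.T) i))) =
      C.act (fun i => (C.triple i).ι (v i) * (C.triple i).τ ((1 : C.T) i)) t x := by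
    refine Eq.trans ?_ h
    funext i
    rw [affinePoint_eq, Pi.one_apply, map_one, one_mul]
  have hk := fun i => max_norm_of_mem_discs (hv i)
  have hu : ∀ i j, ‖(((1 : C.T) i j : ℂˣ) : ℂ)‖ = 1 := by simp
  have hcol : ∀ i, (SL2.upper (z i) * SL2.refl) 0 0 = -z i ∧
      (SL2.upper (z i) * SL2.refl) 1 0 = -1 := by
    intro i
    rw [SL2.mul_apply, SL2.mul_apply]
    simp [SL2.upper, SL2.refl]
  have hlog : ∀ i, Torus.logNorm ((1 : C.T) i) = 0 := fun i => Torus.logNorm_one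
  have hQ : ∀ i, max ‖(Torus.char (C.triple i).root (C.connect t i * (1 : C.T) i) : ℂ) *
      (SL2.upper (z i) * SL2.refl) 0 0‖ ‖(SL2.upper (z i) * SL2.refl) 1 0‖ =
      max (Real.exp ((C.triple i).rootLie (C.incoming t 1 i)) * ‖z i‖) 1 := by
    intro i
    rw [(hcol i).1, (hcol i).2, norm_mul, P1Triple.norm_char_root, norm_neg, norm_neg, norm_one]
    rfl
  have h1 := C.incoming_eq_of_eq_act (N := fun p q => max ‖p‖ ‖q‖) hN h' hk hu
  have h2 := C.log_norm_tildeChar_of_eq_act (N := fun p q => max ‖p‖ ‖q‖) hN h' hk hu lam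
  simp only [hQ, hlog, Pi.zero_apply, zero_add, mul_zero, Finset.sum_const_zero] at h1 h2
  refine ⟨C.incoming t 1, _, ⟨h1, fun i => rfl⟩, ?_⟩
  have h3 : Real.log ‖(C.char (C.reflect lam) (1 : C.T) : ℂ)‖ = 0 := by
    have : C.char (C.reflect lam) (1 : C.T) = 1 :=
      Finset.prod_eq_one fun i _ => Torus.char_one _
    simp [this]
  rw [h3, add_zero] at h2
  rw [← h2, Real.exp_log (by simp), h, hf.2, norm_mul]
  exact mul_le_mul_of_nonneg_right (hB v hv) (norm_nonneg _)

lemma IsGrowth.height_nonneg {z : Fin ℓ → ℂ} {X : C.LieT} {Q : Fin ℓ → ℝ}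
    (h : C.IsGrowth z X Q) (i : Fin ℓ) : 0 ≤ Q i := by
  rw [h.height]
  exact Real.log_nonneg (le_max_right _ _)

lemma IsGrowth.height_le {z : Fin ℓ → ℂ} {X : C.LieT} {Q : Fin ℓ → ℝ}
    (h : C.IsGrowth z X Q) (i : Fin ℓ) :
    Q i ≤ |(C.triple i).rootLie (X i)| + Real.log (1 + ‖z i‖) := by
  rw [h.height, ← Real.log_exp |(C.triple i).rootLie (X i)|,
    ← Real.log_mul (Real.exp_pos _).ne' (by positivity)]
  apply Real.log_le_log (by positivity)
  have h1 : 1 ≤ Real.exp |(C.triple i).rootLie (X i)| := Real.one_le_exp (abs_nonneg _)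
  have h2 : Real.exp ((C.triple i).rootLie (X i)) ≤ Real.exp |(C.triple i).rootLie (X i)| :=
    Real.exp_le_exp.2 (le_abs_self _)
  have h3 := norm_nonneg (z i)
  apply max_le <;> nlinarith

/-- Sections have polynomial growth in the affine coordinates. -/
lemma exists_height_le (lam : C.Weight) : ∃ M : ℕ, ∀ z X Q, C.IsGrowth z X Q →
    Real.exp (∑ i, ((C.triple i).level (lam i) : ℝ) * Q i) ≤ ∏ i, (1 + ‖z i‖) ^ M := by
  -- Along the filter `⊤`, `IsBigO` is a bound on the whole type `S` of growth data.
  let S := {s : (Fin ℓ → ℂ) × C.LieT × (Fin ℓ → ℝ) // C.IsGrowth s.1 s.2.1 s.2.2}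
  let Λ : S → ℝ := fun s => ∑ i, Real.log (1 + ‖s.1.1 i‖)
  have hΛ : ∀ (s : S) i, 0 ≤ Real.log (1 + ‖s.1.1 i‖) :=
    fun s i => Real.log_nonneg (by linarith [norm_nonneg (s.1.1 i)])
  have hΛ0 : ∀ s, 0 ≤ Λ s := fun s => Finset.sum_nonneg fun i _ => hΛ s i
  have hroot : ∀ i, (∀ k, (fun s : S => s.1.2.1 i k) =O[⊤] Λ) →
      (fun s : S => (C.triple i).rootLie (s.1.2.1 i)) =O[⊤] Λ := by
    intro i h
    simp only [P1Triple.rootLie]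
    exact Asymptotics.IsBigO.fun_sum fun k _ => (h k).const_mul_left _
  have hQ : ∀ i, (∀ k, (fun s : S => s.1.2.1 i k) =O[⊤] Λ) →
      (fun s : S => s.1.2.2 i) =O[⊤] Λ := by
    intro i h
    have h1 : (fun s : S => |(C.triple i).rootLie (s.1.2.1 i)| + Real.log (1 + ‖s.1.1 i‖))
        =O[⊤] Λ := by
      refine (hroot i h).abs_left.add (Asymptotics.IsBigO.of_bound 1 (Filter.Eventually.of_forall
        fun s => ?_))
      rw [one_mul, Real.norm_of_nonneg (hΛ s i), Real.norm_of_nonneg (hΛ0 s)]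
      exact Finset.single_le_sum (f := fun i => Real.log (1 + ‖s.1.1 i‖)) (fun i _ => hΛ s i)
        (Finset.mem_univ i)
    refine Asymptotics.IsBigO.trans (Asymptotics.IsBigO.of_bound 1 (Filter.Eventually.of_forall
        fun s => ?_)) h1
    rw [one_mul, Real.norm_of_nonneg (s.2.height_nonneg C i)]
    exact (s.2.height_le C i).trans (le_abs_self _)
  have hX : ∀ i k, (fun s : S => s.1.2.1 i k) =O[⊤] Λ := by
    intro i
    refine downward_induction (p := fun i => ∀ k, (fun s : S => s.1.2.1 i k) =O[⊤] Λ)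
      (fun i ih k => ?_) i
    have he : (fun s : S => s.1.2.1 i k) = fun s => C.lieConnect (fun j k =>
        (C.triple j).reflectLie (s.1.2.1 j) k + (C.triple j).coroot k * s.1.2.2 j) i k :=
      funext fun s => congrFun (s.2.incoming i) k
    rw [he]
    simp only [lieConnect]
    split_ifs with hi
    · simp only [Matrix.vecMul, dotProduct, P1Triple.reflectLie_apply]
      refine Asymptotics.IsBigO.fun_sum fun m _ => ?_
      simp only [mul_comm _ (((C.γ i hi).map (Int.cast : ℤ → ℝ)) m k)]
      refine Asymptotics.IsBigO.const_mul_left (.add (.sub (ih hi m) ?_) ?_) _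
      · simp only [mul_comm _ ((C.triple _).coroot m : ℝ)]
        exact (hroot _ (ih hi)).const_mul_left _
      · exact (hQ _ (ih hi)).const_mul_left _
    · simp only [Pi.zero_apply]
      exact Asymptotics.isBigO_zero _ _
  have hsum : (fun s : S => ∑ i, ((C.triple i).level (lam i) : ℝ) * s.1.2.2 i) =O[⊤] Λ :=
    Asymptotics.IsBigO.fun_sum fun i _ => (hQ i (hX i)).const_mul_left _
  obtain ⟨c, hc⟩ := Asymptotics.isBigO_top.1 hsum
  refine ⟨⌈c⌉₊, fun z X Q h => ?_⟩
  have h1 := hc ⟨(z, X, Q), h⟩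
  rw [Real.norm_of_nonneg (hΛ0 _)] at h1
  have h2 : ∑ i, ((C.triple i).level (lam i) : ℝ) * Q i ≤
      ⌈c⌉₊ * ∑ i, Real.log (1 + ‖z i‖) :=
    (le_abs_self _).trans (h1.trans
      (mul_le_mul_of_nonneg_right (Nat.le_ceil c) (hΛ0 ⟨(z, X, Q), h⟩)))
  refine (Real.exp_le_exp.2 h2).trans_eq ?_
  rw [Finset.prod_pow, Real.exp_nat_mul, Real.exp_sum]
  congr 1
  exact Finset.prod_congr rfl fun i _ => Real.exp_log (by positivity)

/-- The radii at which the coordinates `z'_i` have the moduli `e^{y_i}`. -/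
lemma exists_radii (y : Fin ℓ → ℝ) : ∃ r : Fin ℓ → ℝ, (∀ i, 0 < r i) ∧
    (∀ z X Q, (∀ i, ‖z i‖ = r i) → C.IsGrowth z X Q → ∀ i, Q i = max (y i) 0) ∧
    ∀ n : Fin ℓ → ℝ, ∑ i, n i * Real.log (r i) = ∑ i, n i * y i -
      ∑ i, max (y i) 0 * ∑ k, C.drift n i k * (C.triple i).coroot k := by
  obtain ⟨X, hX⟩ : ∃ X : C.LieT, ∀ i, X i = C.lieConnect (fun j k =>
      (C.triple j).reflectLie (X j) k + (C.triple j).coroot k * max (y j) 0) i := by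
    set A : C.LieT := fun i k => -((C.triple i).coroot k * max (y i) 0) with hA
    have hr : ∀ i, (C.triple i).rootLie (A i) = -(2 * max (y i) 0) := by
      intro i
      rw [← (C.triple i).rootLie_coroot, P1Triple.rootLie, P1Triple.rootLie, Finset.sum_mul,
        ← Finset.sum_neg_distrib]
      exact Finset.sum_congr rfl fun k _ => by simp only [hA]; ring
    refine ⟨C.transport A - A, fun i => ?_⟩
    rw [Pi.sub_apply, transport_eq, add_sub_cancel_left]
    congr 1
    funext j k
    have h1 : (C.triple j).rootLie ((C.transport A - A) j) =
        (C.triple j).rootLie (C.transport A j) - (C.triple j).rootLie (A j) := by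
      simp only [P1Triple.rootLie, Pi.sub_apply, mul_sub, Finset.sum_sub_distrib]
    rw [P1Triple.reflectLie_apply, P1Triple.reflectLie_apply, h1, hr]
    simp only [Pi.sub_apply, hA]
    ring
  refine ⟨fun i => Real.exp (y i - (C.triple i).rootLie (X i)), fun i => Real.exp_pos _, ?_, ?_⟩
  · intro z X' Q hz h
    have hQ : ∀ i, X' i = X i → Q i = max (y i) 0 := by
      intro i hi
      rw [h.height, hi, hz, ← Real.exp_add, add_sub_cancel]
      rcases le_total (y i) 0 with h0 | h0
      · rw [max_eq_right h0, max_eq_right (Real.exp_le_one_iff.2 h0), Real.log_one]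
      · rw [max_eq_left h0, max_eq_left (Real.one_le_exp h0), Real.log_exp]
    have hX' : ∀ i, X' i = X i := downward_induction fun i ih => by
      rw [h.incoming, hX, lieConnect, lieConnect]
      split_ifs with hi
      · simp only [ih hi, hQ _ (ih hi)]
      · rfl
    exact fun i => hQ i (hX' i)
  · intro n
    have h0 : C.pairing n 0 = 0 := by
      rw [← sum_covector_mul]
      simp
    have h1 := C.sum_mul_rootLie_eq (A := 0) (X := X) (q := fun i => max (y i) 0) n (fun i => by
      rw [Pi.zero_apply, zero_add]
      exact hX i)
    simp only [Real.log_exp, mul_sub, Finset.sum_sub_distrib, h1, h0, zero_add]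

/-- If a section is not smaller than the monomial `z ^ n` in the sense of Cauchy's estimate, then
`n` lies in the polytope. -/
lemma mem_latticePolytope_of_le {f : C.G → ℂ} (hf : f ∈ C.sections lam) {n : Fin ℓ → ℤ} {c : ℂ}
    (hc : c ≠ 0) (h : ∀ (r : Fin ℓ → ℝ) (B : ℝ), (∀ i, 0 < r i) →
      (∀ z : Fin ℓ → ℂ, (∀ i, ‖z i‖ = r i) → ‖f (C.affinePoint z)‖ ≤ B) →
      ‖c‖ * ∏ i, r i ^ n i ≤ B) : n ∈ C.latticePolytope lam := by
  obtain ⟨B, hB0, hB⟩ := C.exists_norm_le hf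
  -- The estimate on the torus where the coordinates `z'_i` have the moduli `e^{y_i}`.
  have key : ∀ y : Fin ℓ → ℝ, ∑ i, n i * y i - ∑ i, ((C.cap lam n i : ℤ) : ℝ) * max (y i) 0 ≤
      Real.log B - Real.log ‖c‖ := by
    intro y
    obtain ⟨r, hr0, hr1, hr2⟩ := C.exists_radii y
    have h1 := h r (B * Real.exp (∑ i, ((C.triple i).level (lam i) : ℝ) * max (y i) 0)) hr0 (by
      intro z hz
      obtain ⟨X, Q, hQ, hle⟩ := hB z
      simpa only [hr1 z X Q hz hQ] using hle)
    have hp : 0 < ∏ i, r i ^ n i := Finset.prod_pos fun i _ => zpow_pos (hr0 i) _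
    have h2 := Real.log_le_log (mul_pos (norm_pos_iff.2 hc) hp) h1
    rw [Real.log_mul (norm_pos_iff.2 hc).ne' hp.ne', Real.log_mul hB0.ne' (Real.exp_pos _).ne',
      Real.log_exp, Real.log_prod (fun i _ => (zpow_pos (hr0 i) _).ne')] at h2
    simp only [Real.log_zpow] at h2
    rw [hr2 fun i => (n i : ℝ)] at h2
    simp only [intCast_cap]
    simp only [cap, add_mul, Finset.sum_add_distrib]
    simp only [mul_comm (max _ _) (∑ k, _)] at h2
    linarith
  have key1 : ∀ i (Y : ℝ), n i * Y - ((C.cap lam n i : ℤ) : ℝ) * max Y 0 ≤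
      Real.log B - Real.log ‖c‖ := by
    intro i Y
    have h1 := key (Pi.single i Y)
    have h2 : ∑ j, (n j : ℝ) * (Pi.single i Y : Fin ℓ → ℝ) j = n i * Y := by
      simp [Pi.single_apply]
    have h3 : ∑ j, ((C.cap lam n j : ℤ) : ℝ) * max ((Pi.single i Y : Fin ℓ → ℝ) j) 0 =
        ((C.cap lam n i : ℤ) : ℝ) * max Y 0 := by
      rw [Finset.sum_eq_single i]
      · simp
      · intro j _ hj
        simp [Pi.single_eq_of_ne hj]
      · simp
    rwa [h2, h3] at h1
  set D := Real.log B - Real.log ‖c‖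
  -- The left-hand side of `key1` is linear in `Y` on both half-lines, so it is bounded above only if
  -- the slopes have the right signs.
  intro i
  constructor
  · by_contra hn
    have hn1 : (n i : ℝ) ≤ -1 := by
      have : n i ≤ -1 := by omega
      exact_mod_cast this
    have h1 := key1 i (-(|D| + 1))
    rw [max_eq_right (by linarith [abs_nonneg D]), mul_zero, sub_zero] at h1
    nlinarith [le_abs_self D, abs_nonneg D]
  · by_contra hn
    have hn1 : ((C.cap lam n i : ℤ) : ℝ) + 1 ≤ n i := by
      have : C.cap lam n i + 1 ≤ n i := by omega
      exact_mod_cast this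
    have h1 := key1 i (|D| + 1)
    rw [max_eq_left (by linarith [abs_nonneg D])] at h1
    nlinarith [le_abs_self D, abs_nonneg D]

end P1Chain

/-! ### Entire functions of polynomial growth -/

namespace PolynomialGrowth

/-- An entire function of one variable of polynomial growth is a polynomial. -/
lemma exists_polynomial {G : ℂ → ℂ} (hG : Differentiable ℂ G) {B : ℝ} {M : ℕ}
    (h : ∀ w, ‖G w‖ ≤ B * (1 + ‖w‖) ^ M) :
    ∃ p : Polynomial ℂ, p.natDegree ≤ M ∧ ∀ w, G w = p.eval w := by
  have hB : 0 ≤ B := by simpa using (norm_nonneg _).trans (h 0)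
  have hz : ∀ k, M < k → iteratedDeriv k G 0 = 0 := by
    intro k hk
    have h1 : ∀ R : ℝ, 1 ≤ R →
        ‖iteratedDeriv k G 0‖ ≤ (k.factorial * (B * 2 ^ M)) * R⁻¹ := by
      intro R hR
      have hR0 : 0 < R := by linarith
      refine (norm_iteratedDeriv_le_of_forall_mem_sphere_norm_le k hR0 hG.diffContOnCl
        (C := B * (2 * R) ^ M) fun z hz => (h z).trans ?_).trans ?_
      · have hz' : ‖z‖ = R := by simpa using hz
        rw [hz']
        gcongr
        linarith
      · rw [mul_pow, div_le_iff₀ (pow_pos hR0 _)]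
        have h2 : R ^ M ≤ R⁻¹ * R ^ k := by
          rw [inv_mul_eq_div, le_div_iff₀ hR0, ← pow_succ]
          exact pow_le_pow_right₀ hR hk
        calc (k.factorial : ℝ) * (B * (2 ^ M * R ^ M)) = k.factorial * (B * 2 ^ M) * R ^ M := by
              ring
          _ ≤ k.factorial * (B * 2 ^ M) * (R⁻¹ * R ^ k) := by gcongr
          _ = _ := by ring
    have h2 : Filter.Tendsto (fun R : ℝ => (k.factorial * (B * 2 ^ M)) * R⁻¹) Filter.atTop
        (nhds 0) := by
      simpa using tendsto_inv_atTop_zero.const_mul ((k.factorial : ℝ) * (B * 2 ^ M))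
    have h3 := ge_of_tendsto h2 ((Filter.eventually_ge_atTop 1).mono h1)
    exact norm_le_zero_iff.1 h3
  refine ⟨∑ k ∈ Finset.range (M + 1), Polynomial.C (((k.factorial : ℂ))⁻¹ * iteratedDeriv k G 0) *
    Polynomial.X ^ k, ?_, fun w => ?_⟩
  · exact Polynomial.natDegree_sum_le_of_forall_le _ _ fun k hk =>
      (Polynomial.natDegree_C_mul_X_pow_le _ _).trans (Nat.lt_succ_iff.1 (Finset.mem_range.1 hk))
  · rw [← Complex.taylorSeries_eq_of_entire' (c := 0) (z := w) hG,
      tsum_eq_sum (s := Finset.range (M + 1)) fun k hk => by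
        rw [hz k (by rw [Finset.mem_range] at hk; omega)]
        simp]
    simp [Polynomial.eval_finsetSum]

/-- Cauchy's estimate for the coefficients of a polynomial of one variable. -/
lemma norm_coeff_mul_pow_le {K : ℕ} {a : Fin K → ℂ} {r B : ℝ} (hr : 0 < r)
    (h : ∀ w : ℂ, ‖w‖ = r → ‖∑ k, a k * w ^ (k : ℕ)‖ ≤ B) (k : Fin K) :
    ‖a k‖ * r ^ (k : ℕ) ≤ B := by
  have hd : Differentiable ℂ (fun w : ℂ => ∑ k, a k * w ^ (k : ℕ)) := by fun_prop
  have h1 := norm_iteratedDeriv_le_of_forall_mem_sphere_norm_le k hr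
    (hd.diffContOnCl (s := Metric.ball 0 r)) (C := B) fun z hz => h z (by simpa using hz)
  have h2 : iteratedDeriv k (fun w : ℂ => ∑ k, a k * w ^ (k : ℕ)) 0 = (k : ℕ).factorial * a k := by
    rw [iteratedDeriv_fun_sum fun i _ => by fun_prop, Finset.sum_eq_single k]
    · rw [iteratedDeriv_const_mul_field, iteratedDeriv_fun_pow_zero, if_pos rfl, mul_comm]
    · intro j _ hj
      rw [iteratedDeriv_const_mul_field, iteratedDeriv_fun_pow_zero,
        if_neg fun e => hj (Fin.ext e.symm), Nat.cast_zero, mul_zero]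
    · simp
  rw [h2, norm_mul, Complex.norm_natCast, le_div_iff₀ (pow_pos hr _), mul_assoc] at h1
  exact le_of_mul_le_mul_left h1 (by positivity)

variable {ℓ : ℕ}

lemma sum_fin_succ_eq {M : Type*} [AddCommMonoid M] {K : ℕ} (φ : (Fin (ℓ + 1) → Fin K) → M) :
    ∑ n, φ n = ∑ k, ∑ n : Fin ℓ → Fin K, φ (Fin.cons k n) := by
  rw [← (Fin.consEquiv fun _ => Fin K).sum_comp, Fintype.sum_prod_type]
  rfl

/-- An entire function of several variables of polynomial growth is a polynomial. The reduction to
one variable uses the interpolation of the function at `0, …, M` in the first variable. -/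
lemma exists_eq_sum (M : ℕ) {F : (Fin ℓ → ℂ) → ℂ} (hF : Differentiable ℂ F) {B : ℝ}
    (h : ∀ z, ‖F z‖ ≤ B * ∏ i, (1 + ‖z i‖) ^ M) :
    ∃ a : (Fin ℓ → Fin (M + 1)) → ℂ, ∀ z, F z = ∑ n, a n * ∏ i, z i ^ (n i : ℕ) := by
  induction ℓ generalizing B with
  | zero => exact ⟨fun _ => F 0, fun z => by simp [Subsingleton.elim z 0]⟩
  | succ ℓ ih =>
    have hcons : ∀ w : ℂ, ∃ a : (Fin ℓ → Fin (M + 1)) → ℂ,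
        ∀ z : Fin ℓ → ℂ, F (Fin.cons w z) = ∑ n, a n * ∏ i, z i ^ (n i : ℕ) := by
      intro w
      refine ih (F := fun z => F (Fin.cons w z)) (B := B * (1 + ‖w‖) ^ M) ?_ fun z => ?_
      · refine hF.comp (differentiable_pi.2 fun i => ?_)
        refine Fin.cases ?_ (fun i => ?_) i
        · simp
        · simp only [Fin.cons_succ]
          fun_prop
      · refine (h _).trans_eq ?_
        rw [Fin.prod_univ_succ]
        simp [mul_assoc]
    choose a ha using hcons
    have hinj : Set.InjOn (fun j : ℕ => (j : ℂ)) (Finset.range (M + 1)) :=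
      fun i _ j _ hij => by simpa using hij
    set L : ℕ → Polynomial ℂ := Lagrange.basis (Finset.range (M + 1)) (fun j : ℕ => (j : ℂ))
    have hL : ∀ j ∈ Finset.range (M + 1), (L j).natDegree < M + 1 := by
      intro j hj
      rw [Lagrange.natDegree_basis hinj hj]
      simp
    refine ⟨fun n => ∑ j ∈ Finset.range (M + 1), (L j).coeff (n 0) * a j (Fin.tail n), fun z => ?_⟩
    obtain ⟨w, z, rfl⟩ : ∃ (w : ℂ) (z' : Fin ℓ → ℂ), z = Fin.cons w z' :=
      ⟨z 0, Fin.tail z, (Fin.cons_self_tail z).symm⟩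
    obtain ⟨p, hp, hp'⟩ := exists_polynomial (G := fun w => F (Fin.cons w z))
      (B := B * ∏ i, (1 + ‖z i‖) ^ M) (M := M) (by
        refine hF.comp (differentiable_pi.2 fun i => ?_)
        refine Fin.cases ?_ (fun i => ?_) i <;> simp) (fun w => by
        refine (h _).trans_eq ?_
        rw [Fin.prod_univ_succ]
        simp only [Fin.cons_zero, Fin.cons_succ]
        ring)
    have hpL : p = ∑ j ∈ Finset.range (M + 1), Polynomial.C (p.eval (j : ℂ)) * L j := by
      conv_lhs => rw [Lagrange.eq_interpolate (f := p) hinj (by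
        rw [Finset.card_range]
        exact (Polynomial.degree_le_of_natDegree_le hp).trans_lt (by exact_mod_cast M.lt_succ_self))]
      rw [Lagrange.interpolate_apply]
    have hFw : F (Fin.cons w z) = ∑ j ∈ Finset.range (M + 1), F (Fin.cons (j : ℂ) z) *
        ∑ k : Fin (M + 1), (L j).coeff k * w ^ (k : ℕ) := by
      refine (hp' w).trans ?_
      conv_lhs => rw [hpL]
      rw [Polynomial.eval_finsetSum]
      refine Finset.sum_congr rfl fun j hj => ?_
      rw [Polynomial.eval_mul, Polynomial.eval_C, ← hp', Polynomial.eval_eq_sum_range' (hL j hj),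
        Finset.sum_range]
    rw [hFw, sum_fin_succ_eq]
    have h1 : ∀ j ∈ Finset.range (M + 1), F (Fin.cons (j : ℂ) z) *
        ∑ k : Fin (M + 1), (L j).coeff k * w ^ (k : ℕ) = ∑ k : Fin (M + 1),
          ∑ n : Fin ℓ → Fin (M + 1), (L j).coeff k * a j n * (w ^ (k : ℕ) *
            ∏ i, z i ^ (n i : ℕ)) := by
      intro j _
      rw [ha, Finset.sum_mul_sum, Finset.sum_comm]
      exact Finset.sum_congr rfl fun k _ => Finset.sum_congr rfl fun n _ => by ring
    rw [Finset.sum_congr rfl h1, Finset.sum_comm]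
    refine Finset.sum_congr rfl fun k _ => ?_
    rw [Finset.sum_comm]
    refine Finset.sum_congr rfl fun n _ => ?_
    simp only [Fin.prod_univ_succ, Fin.cons_zero, Fin.cons_succ, Fin.tail_cons, Finset.sum_mul]

/-- Cauchy's estimate for the coefficients of a polynomial of several variables. -/
lemma norm_coeff_mul_prod_le {K : ℕ} {a : (Fin ℓ → Fin K) → ℂ} {r : Fin ℓ → ℝ} {B : ℝ}
    (hr : ∀ i, 0 < r i)
    (h : ∀ z : Fin ℓ → ℂ, (∀ i, ‖z i‖ = r i) → ‖∑ n, a n * ∏ i, z i ^ (n i : ℕ)‖ ≤ B)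
    (n : Fin ℓ → Fin K) : ‖a n‖ * ∏ i, r i ^ (n i : ℕ) ≤ B := by
  induction ℓ generalizing B with
  | zero => simpa [Subsingleton.elim n default] using h 0 (fun i => i.elim0)
  | succ ℓ ih =>
    have h1 : ∀ z : Fin ℓ → ℂ, (∀ i, ‖z i‖ = r i.succ) → ∀ k : Fin K,
        ‖∑ m, a (Fin.cons k m) * ∏ i, z i ^ (m i : ℕ)‖ * r 0 ^ (k : ℕ) ≤ B := by
      intro z hz k
      refine norm_coeff_mul_pow_le (a := fun k => ∑ m, a (Fin.cons k m) * ∏ i, z i ^ (m i : ℕ))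
        (hr 0) (fun w hw => ?_) k
      refine Eq.trans_le ?_ (h (Fin.cons w z) (Fin.cases (by simpa using hw) (by simpa using hz)))
      rw [sum_fin_succ_eq]
      simp only [Fin.prod_univ_succ, Fin.cons_zero, Fin.cons_succ, Finset.sum_mul]
      congr 1
      exact Finset.sum_congr rfl fun k _ => Finset.sum_congr rfl fun m _ => by ring
    have h2 := ih (a := fun m => a (Fin.cons (n 0) m)) (r := fun i => r i.succ)
      (B := B / r 0 ^ (n 0 : ℕ)) (fun i => hr _)
      (fun z hz => (le_div_iff₀ (pow_pos (hr 0) _)).2 (h1 z hz (n 0))) (Fin.tail n)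
    rw [Fin.cons_self_tail, le_div_iff₀ (pow_pos (hr 0) _)] at h2
    rw [Fin.prod_univ_succ]
    refine Eq.trans_le ?_ h2
    simp only [Fin.tail]
    ring

end PolynomialGrowth

/-! ### The Laplacian of the Fubini-Study potential -/

/-- The Laplacian of `c log(1 + |w|²)` at the origin. -/
lemma laplacian_mul_log_one_add_sq (c : ℝ) :
    Laplacian.laplacian (fun w : ℂ => c * Real.log (1 + ‖w‖ ^ 2)) (0 : ℂ) = 4 * c := by
  have hsm : ContDiff ℝ 2 (fun w : ℂ => c * Real.log (1 + ‖w‖ ^ 2)) := by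
    refine contDiff_const.mul (ContDiff.log ?_ fun w => by positivity)
    exact contDiff_const.add (contDiff_norm_sq ℝ)
  have key : ∀ e : ℂ, ‖e‖ = 1 →
      iteratedFDeriv ℝ 2 (fun w : ℂ => c * Real.log (1 + ‖w‖ ^ 2)) 0 ![e, e] = 2 * c := by
    intro e he
    have h1 := ContinuousLinearMap.iteratedFDeriv_comp_right
      ((1 : ℝ →L[ℝ] ℝ).smulRight e) hsm (0 : ℝ) (i := 2) le_rfl
    have h2 := congrArg (fun φ => φ ![(1 : ℝ), 1]) h1
    have h3 : (fun w : ℂ => c * Real.log (1 + ‖w‖ ^ 2)) ∘ ((1 : ℝ →L[ℝ] ℝ).smulRight e) =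
        fun t : ℝ => c * Real.log (1 + t ^ 2) := by
      funext t
      simp [he]
    have h4 : ∀ t : ℝ, HasDerivAt (fun t : ℝ => c * Real.log (1 + t ^ 2))
        (c * (2 * t / (1 + t ^ 2))) t := by
      intro t
      have := (((hasDerivAt_pow 2 t).const_add 1).log (by positivity)).const_mul c
      simpa using this
    have h5 : HasDerivAt (fun t : ℝ => c * (2 * t / (1 + t ^ 2))) (2 * c) 0 := by
      have := (((hasDerivAt_id (0 : ℝ)).const_mul 2).div ((hasDerivAt_pow 2 (0 : ℝ)).const_add 1)
        (by norm_num)).const_mul c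
      exact this.congr_deriv (by norm_num [mul_comm])
    have h6 : iteratedDeriv 2 (fun t : ℝ => c * Real.log (1 + t ^ 2)) 0 = 2 * c := by
      rw [iteratedDeriv_succ, iteratedDeriv_one, funext fun t => (h4 t).deriv, h5.deriv]
    have h7 : (fun i : Fin 2 => ((1 : ℝ →L[ℝ] ℝ).smulRight e) (![(1 : ℝ), 1] i)) = ![e, e] := by
      funext i
      fin_cases i <;> simp
    have h8 : (fun _ : Fin 2 => (1 : ℝ)) = ![1, 1] := by
      funext i
      fin_cases i <;> simp
    simp only [h3, ContinuousMultilinearMap.compContinuousLinearMap_apply, map_zero, h7] at h2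
    rw [← h2, ← h6, iteratedDeriv, h8]
  rw [InnerProductSpace.laplacian_eq_iteratedFDeriv_complexPlane]
  simp only []
  rw [key 1 (by simp), key I (by simp)]
  ring

/-! ### The unitary metric and the moment map -/

lemma SL2.norm_sq_add_norm_sq_of_mem_unitaryGroup {k : SL2.Grp}
    (hk : (k : Matrix (Fin 2) (Fin 2) ℂ) ∈ Matrix.unitaryGroup (Fin 2) ℂ) :
    ‖k 0 0‖ ^ 2 + ‖k 1 0‖ ^ 2 = 1 := by
  rw [Matrix.mem_unitaryGroup_iff'] at hk
  have h := congrFun (congrFun hk 0) 0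
  rw [Matrix.mul_apply, Fin.sum_univ_two] at h
  simp only [Matrix.star_apply, Matrix.one_apply_eq, RCLike.star_def, Complex.conj_mul'] at h
  exact_mod_cast h

namespace P1Chain

variable {ℓ : ℕ} (C : P1Chain ℓ) {lam : C.Weight}

/-- The logarithmic data of the Iwasawa decomposition of `(e^{H_i} ι(a_i) τ(t_i))_i`: `X_i` is the
element of the Lie algebra of `T_i` that arrives at the `i`-th component, and `Q_i` is the
coefficient of the coroot in the `T_i`-component. -/
structure IsIwasawa (a : Fin ℓ → SL2.Grp) (t₀ : C.T) (H X : C.LieT) (Q : Fin ℓ → ℝ) : Prop where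
  incoming : ∀ i, X i = H i + C.lieConnect (fun j k => Torus.logNorm (t₀ j) k +
    ((C.triple j).reflectLie (X j) k + (C.triple j).coroot k * Q j)) i
  height : ∀ i, Q i = 1 / 2 * Real.log
    (Real.exp ((C.triple i).rootLie (X i)) ^ 2 * ‖a i 0 0‖ ^ 2 + ‖a i 1 0‖ ^ 2)

/-- The unitary metric in terms of the Iwasawa decomposition. -/
lemma exists_isIwasawa (lam : C.Weight) (a : Fin ℓ → SL2.Grp) (t₀ h : C.T) :
    ∃ X Q, C.IsIwasawa a t₀ (fun i => Torus.logNorm (h i)) X Q ∧ ∀ v : ℂ, v ≠ 0 →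
      Real.log (C.fiberNorm lam (fun i => (C.triple i).τ (h i) *
        ((C.triple i).ι (a i) * (C.triple i).τ (t₀ i))) v) = Real.log ‖v‖ -
          (∑ i, ∑ j, (lam i j : ℝ) * Torus.logNorm (t₀ i) j +
            ∑ i, ((C.triple i).level (lam i) : ℝ) * Q i +
            Real.log ‖(C.char (C.reflect lam) h : ℂ)‖) := by
  set g : C.G := fun i => (C.triple i).τ (h i) *
    ((C.triple i).ι (a i) * (C.triple i).τ (t₀ i)) with hg
  obtain ⟨x, u, hu, he⟩ := (C.exists_iwasawa g).choose_spec
  set t := (C.exists_iwasawa g).choose with ht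
  choose k s hk hs hks using hu
  have he' : g = C.act (fun i => (C.triple i).ι (k i) * (C.triple i).τ (s i)) t x := by
    rw [he]
    congr 1
    exact funext hks
  have hN : ∀ y p q : ℂ, Real.sqrt (‖y * p‖ ^ 2 + ‖y * q‖ ^ 2) =
      ‖y‖ * Real.sqrt (‖p‖ ^ 2 + ‖q‖ ^ 2) := by
    intro y p q
    rw [norm_mul, norm_mul, mul_pow, mul_pow, ← mul_add, Real.sqrt_mul (by positivity),
      Real.sqrt_sq (norm_nonneg _)]
  have hk1 : ∀ i, Real.sqrt (‖k i 0 0‖ ^ 2 + ‖k i 1 0‖ ^ 2) = 1 := fun i => by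
    rw [SL2.norm_sq_add_norm_sq_of_mem_unitaryGroup (hk i), Real.sqrt_one]
  have hQ : ∀ i, Real.log (Real.sqrt
      (‖(Torus.char (C.triple i).root (C.connect t i * h i) : ℂ) * a i 0 0‖ ^ 2 +
        ‖a i 1 0‖ ^ 2)) = 1 / 2 * Real.log (Real.exp ((C.triple i).rootLie (C.incoming t h i)) ^ 2 *
          ‖a i 0 0‖ ^ 2 + ‖a i 1 0‖ ^ 2) := by
    intro i
    rw [Real.log_sqrt (by positivity), norm_mul, P1Triple.norm_char_root, mul_pow]
    change Real.log (Real.exp ((C.triple i).rootLie (C.incoming t h i)) ^ 2 * _ + _) / 2 = _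
    ring
  have h1 := C.incoming_eq_of_eq_act (N := fun p q => Real.sqrt (‖p‖ ^ 2 + ‖q‖ ^ 2)) hN he' hk1 hs
  have h2 := C.log_norm_tildeChar_of_eq_act (N := fun p q => Real.sqrt (‖p‖ ^ 2 + ‖q‖ ^ 2)) hN he'
    hk1 hs lam
  simp only [hQ] at h1 h2
  refine ⟨C.incoming t h, _, ⟨h1, fun i => rfl⟩, fun v hv => ?_⟩
  rw [← h2, fiberNorm, Real.log_div (norm_ne_zero_iff.2 hv) (by simp)]

variable {C}

lemma IsIwasawa.height_eq_of_eq {a : Fin ℓ → SL2.Grp} {t₀ : C.T} {H H' X X' : C.LieT}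
    {Q Q' : Fin ℓ → ℝ} (h : C.IsIwasawa a t₀ H X Q) (h' : C.IsIwasawa a t₀ H' X' Q')
    {i : Fin ℓ} (hi : X i = X' i) : Q i = Q' i := by
  rw [h.height, h'.height, hi]

lemma IsIwasawa.unique {a : Fin ℓ → SL2.Grp} {t₀ : C.T} {H X X' : C.LieT}
    {Q Q' : Fin ℓ → ℝ} (h : C.IsIwasawa a t₀ H X Q) (h' : C.IsIwasawa a t₀ H X' Q')
    (i : Fin ℓ) : X i = X' i := by
  refine downward_induction (p := fun i => X i = X' i) (fun i ih => ?_) i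
  rw [h.incoming, h'.incoming, lieConnect, lieConnect]
  split_ifs with hi
  · simp only [ih hi, h.height_eq_of_eq h' (ih hi)]
  · rfl

variable (C)

/-- The relative height of the column `(p, q)`, acted on by `e^X` with `α(X) = x`, on the segment
which is the moment polytope of `ℙ¹`. -/
noncomputable def relHeight (x : ℝ) (p q : ℂ) : ℝ :=
  Real.exp x ^ 2 * ‖p‖ ^ 2 / (Real.exp x ^ 2 * ‖p‖ ^ 2 + ‖q‖ ^ 2)

lemma relHeight_mem (x : ℝ) (p q : ℂ) : 0 ≤ relHeight x p q ∧ relHeight x p q ≤ 1 := by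
  refine ⟨by rw [relHeight]; positivity, div_le_one_of_le₀ ?_ (by positivity)⟩
  linarith [sq_nonneg ‖q‖]

lemma column_norm_pos (a : SL2.Grp) (x : ℝ) :
    0 < Real.exp x ^ 2 * ‖a 0 0‖ ^ 2 + ‖a 1 0‖ ^ 2 := by
  by_cases h : a 0 0 = 0
  · have h1 : a 1 0 ≠ 0 := by
      intro h1
      have hdet := a.det_coe
      rw [Matrix.det_fin_two, h, h1] at hdet
      simp at hdet
    have := norm_pos_iff.2 h1
    positivity
  · have := norm_pos_iff.2 h
    positivity

lemma hasDerivAt_height {a : SL2.Grp} {φ : ℝ → ℝ} {x' : ℝ} (h : HasDerivAt φ x' 0) :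
    HasDerivAt (fun s => 1 / 2 * Real.log (Real.exp (φ s) ^ 2 * ‖a 0 0‖ ^ 2 + ‖a 1 0‖ ^ 2))
      (relHeight (φ 0) (a 0 0) (a 1 0) * x') 0 := by
  have hp := column_norm_pos a (φ 0)
  have h1 := ((((h.exp.fun_pow 2).mul_const (‖a 0 0‖ ^ 2)).add_const (‖a 1 0‖ ^ 2)).log
    hp.ne').const_mul (1 / 2)
  refine h1.congr_deriv ?_
  rw [relHeight]
  field_simp
  push_cast
  ring

/-- The value of the moment map at the point represented by `(ι(a_i) τ(t_i))_i`: its coordinates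
`J_i` are given recursively by the relative heights in the fibers. -/
lemma momentMap_eq {a : Fin ℓ → SL2.Grp} {t₀ : C.T} {X : C.LieT} {Q : Fin ℓ → ℝ}
    (hX : C.IsIwasawa a t₀ 0 X Q) {J : Fin ℓ → ℝ}
    (hJ : ∀ i, J i = relHeight ((C.triple i).rootLie (X i)) (a i 0 0) (a i 1 0) * C.cap lam J i)
    (A : C.LieT) :
    C.momentMap lam (fun i => (C.triple i).ι (a i) * (C.triple i).τ (t₀ i)) A =
      C.pairing J A := by
  choose Y R hY hlog using fun s : ℝ =>
    C.exists_isIwasawa lam a t₀ (C.exp fun i k => ((s * A i k : ℝ) : ℂ))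
  have hH : ∀ s : ℝ, (fun i => Torus.logNorm (C.exp (fun i k => ((s * A i k : ℝ) : ℂ)) i)) =
      fun i k => s * A i k := by
    intro s
    funext i
    exact Torus.logNorm_exp_ofReal _
  simp only [hH] at hY
  have hY0 : ∀ i, Y 0 i = X i := by
    have h0 := hY 0
    simp only [zero_mul] at h0
    exact fun i => h0.unique hX i
  set p : Fin ℓ → ℝ := fun i =>
    relHeight ((C.triple i).rootLie (X i)) (a i 0 0) (a i 1 0) with hp
  have hroot : ∀ i, (∀ k, DifferentiableAt ℝ (fun s => Y s i k) 0) →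
      HasDerivAt (fun s => (C.triple i).rootLie (Y s i))
        ((C.triple i).rootLie fun k => deriv (fun s => Y s i k) 0) 0 := by
    intro i h
    simp only [P1Triple.rootLie]
    exact HasDerivAt.fun_sum fun k _ => (h k).hasDerivAt.const_mul _
  have hR : ∀ i, (∀ k, DifferentiableAt ℝ (fun s => Y s i k) 0) →
      HasDerivAt (fun s => R s i)
        (p i * (C.triple i).rootLie fun k => deriv (fun s => Y s i k) 0) 0 := by
    intro i h
    have h1 := hasDerivAt_height (a := a i) (hroot i h)
    rw [hY0] at h1
    exact h1.congr_of_eventuallyEq (Filter.Eventually.of_forall fun s => (hY s).height i)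
  have hstep : ∀ i (hi : i.val + 1 < ℓ),
      (∀ k, DifferentiableAt ℝ (fun s => Y s ⟨i.val + 1, hi⟩ k) 0) → ∀ k,
      HasDerivAt (fun s => Y s i k) (A i k + C.lieConnect (fun j k =>
        (C.triple j).reflectLie (fun k => deriv (fun s => Y s j k) 0) k + (C.triple j).coroot k *
          (p j * (C.triple j).rootLie fun k => deriv (fun s => Y s j k) 0)) i k) 0 := by
    intro i hi h k
    have he : (fun s => Y s i k) = fun s => s * A i k + C.lieConnect (fun j k =>
        Torus.logNorm (t₀ j) k + ((C.triple j).reflectLie (Y s j) k +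
          (C.triple j).coroot k * R s j)) i k :=
      funext fun s => congrFun ((hY s).incoming i) k
    rw [he]
    simp only [lieConnect, dif_pos hi, Matrix.vecMul, dotProduct]
    refine HasDerivAt.add ?_ (HasDerivAt.fun_sum fun m _ => HasDerivAt.mul_const
      (HasDerivAt.const_add _ (HasDerivAt.add ?_ ((hR _ h).const_mul _))) _)
    · simpa using (hasDerivAt_id (0 : ℝ)).mul_const (A i k)
    · exact (h m).hasDerivAt.sub ((hroot _ h).mul_const _)
  have hlast : ∀ i, ¬ i.val + 1 < ℓ → ∀ k, HasDerivAt (fun s => Y s i k) (A i k) 0 := by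
    intro i hi k
    have he : (fun s => Y s i k) = fun s => s * A i k := by
      funext s
      have := congrFun ((hY s).incoming i) k
      rw [this]
      simp [lieConnect, hi]
    rw [he]
    simpa using (hasDerivAt_id (0 : ℝ)).mul_const (A i k)
  have hd : ∀ i k, DifferentiableAt ℝ (fun s => Y s i k) 0 := by
    intro i
    refine downward_induction (p := fun i => ∀ k, DifferentiableAt ℝ (fun s => Y s i k) 0)
      (fun i ih k => ?_) i
    by_cases hi : i.val + 1 < ℓ
    · exact (hstep i hi (ih hi) k).differentiableAt
    · exact (hlast i hi k).differentiableAt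
  set Y' : C.LieT := fun i k => deriv (fun s => Y s i k) 0 with hY'
  have hrec : ∀ i, Y' i = A i + C.lieConnect (fun j k => (C.triple j).reflectLie (Y' j) k +
      (C.triple j).coroot k * (p j * (C.triple j).rootLie (Y' j))) i := by
    intro i
    funext k
    by_cases hi : i.val + 1 < ℓ
    · exact (hstep i hi (hd _) k).deriv
    · rw [Pi.add_apply, lieConnect, dif_neg hi, Pi.zero_apply, add_zero]
      exact (hlast i hi k).deriv
  have hdual := C.sum_mul_rootLie_eq J hrec
  have hderiv : HasDerivAt (fun s : ℝ => Real.log (C.fiberNorm lam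
      (C.torus (C.exp fun i k => ((s * A i k : ℝ) : ℂ)) *
        fun i => (C.triple i).ι (a i) * (C.triple i).τ (t₀ i))
      (C.char (C.reflect lam) (C.exp fun i k => ((s * A i k : ℝ) : ℂ))) ^ 2))
      (-2 * ∑ i, ((C.triple i).level (lam i) : ℝ) * (p i * (C.triple i).rootLie (Y' i))) 0 := by
    have h1 : HasDerivAt (fun s : ℝ => -2 * (∑ i, ∑ j, (lam i j : ℝ) * Torus.logNorm (t₀ i) j +
        ∑ i, ((C.triple i).level (lam i) : ℝ) * R s i))
        (-2 * ∑ i, ((C.triple i).level (lam i) : ℝ) * (p i * (C.triple i).rootLie (Y' i))) 0 :=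
      ((HasDerivAt.fun_sum fun i _ => (hR i (hd i)).const_mul _).const_add _).const_mul _
    refine h1.congr_of_eventuallyEq (Filter.Eventually.of_forall fun s => ?_)
    have h2 := hlog s (C.char (C.reflect lam) (C.exp fun i k => ((s * A i k : ℝ) : ℂ)))
      (Units.ne_zero _)
    change Real.log (C.fiberNorm lam (fun i => _) _ ^ 2) = _
    rw [Real.log_pow]
    refine (congrArg _ h2).trans ?_
    push_cast
    ring
  rw [momentMap, hderiv.deriv]
  have h3 : ∑ i, ((C.triple i).level (lam i) : ℝ) * (p i * (C.triple i).rootLie (Y' i)) =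
      ∑ i, J i * (C.triple i).rootLie (Y' i) - ∑ i, p i * (C.triple i).rootLie (Y' i) *
        ∑ k, C.drift J i k * (C.triple i).coroot k := by
    rw [← Finset.sum_sub_distrib]
    refine Finset.sum_congr rfl fun i _ => ?_
    rw [hJ i, cap]
    ring
  rw [h3, hdual]
  ring

/-- The point `J` with `J_i = p_i cap_i(J)`, for `p` in the unit cube. -/
noncomputable def cubePoint (lam : C.Weight) (p : Fin ℓ → ℝ) (i : Fin ℓ) : ℝ :=
  p i * C.cap lam (fun j => if _h : j < i then cubePoint lam p j else 0) i
termination_by i.val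

lemma cubePoint_eq (lam : C.Weight) (p : Fin ℓ → ℝ) (i : Fin ℓ) :
    C.cubePoint lam p i = p i * C.cap lam (C.cubePoint lam p) i := by
  rw [cubePoint]
  congr 1
  refine C.cap_congr lam fun j hj => ?_
  rw [dif_pos hj]

lemma eq_cubePoint {p J : Fin ℓ → ℝ} (i : Fin ℓ) (h : ∀ j ≤ i, J j = p j * C.cap lam J j) :
    J i = C.cubePoint lam p i := by
  induction i using WellFoundedLT.induction with
  | _ i ih =>
    rw [h i le_rfl, cubePoint_eq,
      C.cap_congr lam fun j hj => ih j hj fun m hm => h m (hm.trans hj.le)]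

end P1Chain

namespace P1Chain

variable {ℓ : ℕ} (C : P1Chain ℓ) {lam : C.Weight}

/-! ### Positivity and the moment polytope -/

/-- `cubePoint` is affine in each variable. -/
lemma cubePoint_eq_combination (lam : C.Weight) (p : Fin ℓ → ℝ) (k i : Fin ℓ) :
    C.cubePoint lam p i = (1 - p k) * C.cubePoint lam (Function.update p k 0) i +
      p k * C.cubePoint lam (Function.update p k 1) i := by
  symm
  refine C.eq_cubePoint (J := fun i => (1 - p k) * C.cubePoint lam (Function.update p k 0) i +
      p k * C.cubePoint lam (Function.update p k 1) i) i fun j _ => ?_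
  rw [C.cap_combination lam (sub_add_cancel 1 (p k)), cubePoint_eq, C.cubePoint_eq lam _ j]
  by_cases hj : j = k
  · subst hj
    have h : C.cap lam (C.cubePoint lam (Function.update p j 0)) j =
        C.cap lam (C.cubePoint lam (Function.update p j 1)) j := by
      refine C.cap_congr lam fun m hm => C.eq_cubePoint m fun m' hm' => ?_
      have hne : m' ≠ j := (hm'.trans_lt hm).ne
      rw [cubePoint_eq, Function.update_of_ne hne, Function.update_of_ne hne]
    rw [Function.update_self, Function.update_self, h]
    ring
  · rw [Function.update_of_ne hj, Function.update_of_ne hj]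
    ring

/-- If the caps are positive at the vertices of the cube, then they are positive on the cube. -/
lemma cap_cubePoint_pos (h : ∀ p : Fin ℓ → ℝ, (∀ j, p j = 0 ∨ p j = 1) →
      ∀ i, 0 < C.cap lam (C.cubePoint lam p) i)
    {p : Fin ℓ → ℝ} (hp : ∀ j, 0 ≤ p j ∧ p j ≤ 1) (i : Fin ℓ) :
    0 < C.cap lam (C.cubePoint lam p) i := by
  suffices key : ∀ (s : Finset (Fin ℓ)) (p : Fin ℓ → ℝ), (∀ j, 0 ≤ p j ∧ p j ≤ 1) →
      (∀ j ∉ s, p j = 0 ∨ p j = 1) → 0 < C.cap lam (C.cubePoint lam p) i from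
    key Finset.univ p hp fun j hj => absurd (Finset.mem_univ j) hj
  intro s
  induction s using Finset.induction_on with
  | empty => exact fun p _ hp => h p (fun j => hp j (Finset.notMem_empty j)) i
  | insert k s hk ih =>
    intro p hp hs
    have key : ∀ c : ℝ, c = 0 ∨ c = 1 →
        0 < C.cap lam (C.cubePoint lam (Function.update p k c)) i := by
      intro c hc
      refine ih _ (fun j => ?_) fun j hj => ?_
      · by_cases hjk : j = k
        · subst hjk
          rw [Function.update_self]
          rcases hc with rfl | rfl <;> norm_num
        · rw [Function.update_of_ne hjk]
          exact hp j
      · by_cases hjk : j = k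
        · subst hjk
          rwa [Function.update_self]
        · rw [Function.update_of_ne hjk]
          exact hs j (by simp [hjk, hj])
    have h0 := key 0 (Or.inl rfl)
    have h1 := key 1 (Or.inr rfl)
    rw [funext (C.cubePoint_eq_combination lam p k),
      C.cap_combination lam (sub_add_cancel 1 (p k))]
    obtain ⟨hp0, hp1⟩ := hp k
    rcases hp0.eq_or_lt with he | hlt
    · rw [← he]
      linarith
    · nlinarith [mul_pos hlt h1, mul_nonneg (sub_nonneg.2 hp1) h0.le]

/-- At a fixed point of the torus, the curvature in the direction of the `i`-th coordinate is given
by the cap, because the potential restricted to this direction is `cap · log(1 + |w|²)`. -/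
lemma cap_pos_of_isPositive (hpos : C.IsPositive lam) {p : Fin ℓ → ℝ}
    (hp : ∀ j, p j = 0 ∨ p j = 1) (i : Fin ℓ) : 0 < C.cap lam (C.cubePoint lam p) i := by
  set J := C.cubePoint lam p with hJ
  set a : Fin ℓ → SL2.Grp := fun j => if j = i then 1 else if p j = 1 then 1 else SL2.refl with ha
  have h := hpos (fun j => (C.triple j).ι (a j)) (Pi.single i 1) (by simp)
  have key : ∀ w : ℂ, - Real.log (C.fiberNorm lam (fun j => (C.triple j).ι (a j) *
      (C.triple j).ι (SL2.lower (w * (Pi.single i 1 : Fin ℓ → ℂ) j))) 1 ^ 2) =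
      C.cap lam J i * Real.log (1 + ‖w‖ ^ 2) := by
    intro w
    set b : Fin ℓ → SL2.Grp := fun j => a j * SL2.lower (w * (Pi.single i 1 : Fin ℓ → ℂ) j) with hb
    obtain ⟨X, Q, hX, hlog⟩ := C.exists_isIwasawa lam b 1 1
    have hone : ∀ j, Torus.logNorm ((1 : C.T) j) = 0 := fun j => Torus.logNorm_one
    have hchar : C.char (C.reflect lam) (1 : C.T) = 1 :=
      Finset.prod_eq_one fun i _ => Torus.char_one _
    have hlog1 := hlog 1 one_ne_zero
    simp only [hchar, Pi.one_apply, map_one, one_mul, mul_one, Torus.logNorm_one, Pi.zero_apply,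
      mul_zero, Finset.sum_const_zero, zero_add, Units.val_one, norm_one, Real.log_one, add_zero,
      zero_sub] at hlog1
    have hrec : ∀ j, X j = (0 : C.LieT) j + C.lieConnect (fun j k =>
        (C.triple j).reflectLie (X j) k + (C.triple j).coroot k * Q j) j := by
      intro j
      have := hX.incoming j
      simp only [hone, Pi.zero_apply, zero_add] at this
      rw [Pi.zero_apply, zero_add]
      exact this
    have hbi : b i 0 0 = 1 ∧ b i 1 0 = w := by
      have : b i = SL2.lower w := by simp [hb, ha]
      rw [this]
      simp [SL2.lower]
    have hb1 : ∀ j, j ≠ i → p j = 1 → b j 0 0 = 1 ∧ b j 1 0 = 0 := by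
      intro j hj hpj
      simp [hb, ha, hj, hpj, SL2.lower_zero]
    have hb0 : ∀ j, j ≠ i → p j = 0 → b j 0 0 = 0 ∧ b j 1 0 = -1 := by
      intro j hj hpj
      have : b j = SL2.refl := by simp [hb, ha, hj, hpj, SL2.lower_zero]
      rw [this]
      simp [SL2.refl]
    have hQ : ∀ j, j ≠ i → Q j = p j * (C.triple j).rootLie (X j) := by
      intro j hj
      rcases hp j with h0 | h1
      · rw [hX.height, (hb0 j hj h0).1, (hb0 j hj h0).2, h0]
        simp
      · rw [hX.height, (hb1 j hj h1).1, (hb1 j hj h1).2, h1]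
        simp [Real.log_pow]
    have hzero : ∀ j, i ≤ j → X j = 0 := by
      intro j
      refine downward_induction (p := fun j => i ≤ j → X j = 0) (fun j ih hij => ?_) j
      rw [hrec, Pi.zero_apply, zero_add, lieConnect]
      split_ifs with hj
      · have hlt : i < ⟨j.val + 1, hj⟩ := lt_of_le_of_lt hij (by simp [Fin.lt_def])
        have h0 := ih hj hlt.le
        have h1 : (C.triple ⟨j.val + 1, hj⟩).rootLie 0 = 0 := by simp [P1Triple.rootLie]
        have h2 : (fun k => (C.triple ⟨j.val + 1, hj⟩).reflectLie (X ⟨j.val + 1, hj⟩) k +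
            (C.triple ⟨j.val + 1, hj⟩).coroot k * Q ⟨j.val + 1, hj⟩) = 0 := by
          funext k
          rw [hQ _ hlt.ne', h0, P1Triple.reflectLie_apply, h1]
          simp
        rw [h2, Matrix.zero_vecMul]
      · rfl
    have hroot : (C.triple i).rootLie (X i) = 0 := by
      rw [hzero i le_rfl]
      simp [P1Triple.rootLie]
    have hQi : Q i = 1 / 2 * Real.log (1 + ‖w‖ ^ 2) := by
      rw [hX.height, hroot, hbi.1, hbi.2]
      simp
    have hpair : C.pairing J 0 = 0 := by
      rw [← sum_covector_mul]
      simp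
    have hdual := C.sum_mul_rootLie_eq J hrec
    rw [hpair, zero_add] at hdual
    have hsum : ∑ j, ((C.triple j).level (lam j) : ℝ) * Q j = C.cap lam J i * Q i := by
      have h1 : ∑ j, ((C.triple j).level (lam j) : ℝ) * Q j =
          ∑ j, (C.cap lam J j * Q j - J j * (C.triple j).rootLie (X j)) := by
        rw [Finset.sum_sub_distrib, hdual, ← Finset.sum_sub_distrib]
        refine Finset.sum_congr rfl fun j _ => ?_
        rw [cap]
        ring
      rw [h1, Finset.sum_eq_single i]
      · rw [hroot, mul_zero, sub_zero]
      · intro j _ hj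
        rw [hQ j hj, hJ, C.cubePoint_eq lam p j]
        ring
      · simp
    have he : (fun j => (C.triple j).ι (a j) *
        (C.triple j).ι (SL2.lower (w * (Pi.single i 1 : Fin ℓ → ℂ) j))) =
        fun j => (C.triple j).ι (b j) := by
      funext j
      rw [hb, map_mul]
    rw [he, Real.log_pow, hlog1, hsum, hQi]
    push_cast
    ring
  simp only [key, laplacian_mul_log_one_add_sq] at h
  linarith

/-- The weights `ϖ_i` are linearly independent. -/
lemma eq_of_pairing_eq {J J' : Fin ℓ → ℝ} (h : ∀ A, C.pairing J A = C.pairing J' A) : J = J' := by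
  have hcov : ∀ i k, C.covector J i k = C.covector J' i k := by
    intro i k
    have h1 := h (Pi.single i (Pi.single k 1))
    rw [← sum_covector_mul, ← sum_covector_mul] at h1
    have h2 : ∀ J : Fin ℓ → ℝ, ∑ j, ∑ m, C.covector J j m *
        (Pi.single i (Pi.single k 1) : C.LieT) j m = C.covector J i k := by
      intro J
      rw [Finset.sum_eq_single i]
      · simp [Pi.single_apply]
      · intro j _ hj
        simp [Pi.single_eq_of_ne hj]
      · simp
    rwa [h2, h2] at h1
  funext i
  induction i using WellFoundedLT.induction with
  | _ i ih =>
    have hroot : ∃ k, (C.triple i).root k ≠ 0 := by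
      by_contra! hcon
      have := (C.triple i).sum_root_mul_coroot
      simp [hcon] at this
    obtain ⟨k, hk⟩ := hroot
    have h1 := hcov i k
    rw [covector, covector, P1Triple.reflectAdd, P1Triple.reflectAdd, C.drift_congr ih] at h1
    have hk' : ((C.triple i).root k : ℝ) ≠ 0 := by exact_mod_cast hk
    exact mul_right_cancel₀ hk' (add_left_cancel h1)

/-- There are rotations with a given relative height of the first column. -/
lemma exists_relHeight_eq {p : ℝ} (h0 : 0 ≤ p) (h1 : p ≤ 1) : ∃ a : SL2.Grp,
    ‖a 0 0‖ ^ 2 = p ∧ ‖a 1 0‖ ^ 2 = 1 - p := by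
  have hs : ∀ x : ℝ, 0 ≤ x → ‖((Real.sqrt x : ℝ) : ℂ)‖ ^ 2 = x := fun x hx => by
    rw [Complex.norm_real, Real.norm_of_nonneg (Real.sqrt_nonneg _), Real.sq_sqrt hx]
  have hd : Matrix.det !![((Real.sqrt p : ℝ) : ℂ), -((Real.sqrt (1 - p) : ℝ) : ℂ);
      ((Real.sqrt (1 - p) : ℝ) : ℂ), ((Real.sqrt p : ℝ) : ℂ)] = 1 := by
    rw [Matrix.det_fin_two_of]
    have h2 := Real.mul_self_sqrt h0
    have h3 := Real.mul_self_sqrt (sub_nonneg.2 h1)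
    have h4 : Real.sqrt p * Real.sqrt p + Real.sqrt (1 - p) * Real.sqrt (1 - p) = 1 := by
      rw [h2, h3]
      ring
    rw [neg_mul, sub_neg_eq_add]
    exact_mod_cast h4
  refine ⟨⟨_, hd⟩, ?_, ?_⟩
  · exact hs p h0
  · exact hs (1 - p) (sub_nonneg.2 h1)

/-- The inequalities that define the moment polytope. -/
lemma mem_momentPolytope_iff (hpos : C.IsPositive lam) (J : Fin ℓ → ℝ) :
    J ∈ C.momentPolytope lam ↔ ∀ i, 0 ≤ J i ∧ J i ≤ C.cap lam J i := by
  constructor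
  · rintro ⟨g, hg⟩
    choose a t₀ ha using fun i => (C.triple i).surj (g i)
    have hg' : g = fun i => (C.triple i).ι (a i) * (C.triple i).τ (t₀ i) := funext ha
    obtain ⟨X, Q, hX, -⟩ := C.exists_isIwasawa lam a t₀ 1
    have hone : (fun j => Torus.logNorm ((1 : C.T) j)) = (0 : C.LieT) :=
      funext fun j => Torus.logNorm_one
    rw [hone] at hX
    set p : Fin ℓ → ℝ := fun i =>
      relHeight ((C.triple i).rootLie (X i)) (a i 0 0) (a i 1 0) with hp
    have hp01 : ∀ i, 0 ≤ p i ∧ p i ≤ 1 := fun i => relHeight_mem _ _ _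
    have hJ : J = C.cubePoint lam p := C.eq_of_pairing_eq fun A => by
      rw [← hg, hg', C.momentMap_eq hX (C.cubePoint_eq lam p)]
    have hc := fun i => C.cap_cubePoint_pos (fun p hp i => C.cap_pos_of_isPositive hpos hp i) hp01 i
    intro i
    rw [hJ]
    have h1 := C.cubePoint_eq lam p i
    constructor
    · rw [h1]
      exact mul_nonneg (hp01 i).1 (hc i).le
    · conv_lhs => rw [h1]
      exact mul_le_of_le_one_left (hc i).le (hp01 i).2
  · intro h
    -- If the cap is zero, then so is the coordinate, and the quotient `0 / 0 = 0` is fine.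
    set p : Fin ℓ → ℝ := fun i => J i / C.cap lam J i with hp
    have hcap : ∀ i, 0 ≤ C.cap lam J i := fun i => (h i).1.trans (h i).2
    have hp0 : ∀ i, 0 ≤ p i := fun i => div_nonneg (h i).1 (hcap i)
    have hp1 : ∀ i, p i ≤ 1 := fun i => div_le_one_of_le₀ (h i).2 (hcap i)
    have hJ : ∀ i, J i = p i * C.cap lam J i := by
      intro i
      rcases (hcap i).eq_or_lt with h0 | h0
      · rw [← h0, mul_zero]
        exact le_antisymm ((h i).2.trans_eq h0.symm) (h i).1
      · rw [hp, div_mul_cancel₀ _ h0.ne']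
    choose a ha0 ha1 using fun i => exists_relHeight_eq (hp0 i) (hp1 i)
    have hr0 : ∀ i, (C.triple i).rootLie ((0 : C.LieT) i) = 0 := fun i => by
      simp [P1Triple.rootLie]
    have hX : C.IsIwasawa a 1 0 0 0 := by
      refine ⟨fun i => ?_, fun i => ?_⟩
      · have : (fun j k => Torus.logNorm ((1 : C.T) j) k + ((C.triple j).reflectLie
            ((0 : C.LieT) j) k + (C.triple j).coroot k * (0 : Fin ℓ → ℝ) j)) = (0 : C.LieT) := by
          funext j k
          rw [P1Triple.reflectLie_apply, hr0, Pi.one_apply, Torus.logNorm_one]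
          simp
        rw [this, Pi.zero_apply, zero_add, lieConnect]
        split_ifs <;> simp
      · rw [hr0, ha0, ha1]
        simp
    refine ⟨_, C.momentMap_eq hX fun i => ?_⟩
    rw [hr0, relHeight, ha0, ha1]
    simpa using hJ i

end P1Chain

namespace P1Chain

variable {ℓ : ℕ} (C : P1Chain ℓ) {lam : C.Weight}

/-! ### The basis of monomial sections -/

/-- The recursion for the drift determines finitely many values in each step. -/
lemma finite_latticePolytope (lam : C.Weight) : (C.latticePolytope lam).Finite := by
  have hstep : ∀ i, ((fun n => C.drift n i) '' C.latticePolytope lam).Finite →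
      ((fun n => n i) '' C.latticePolytope lam).Finite := by
    intro i h
    refine (h.biUnion fun δ _ => Set.finite_Icc (0 : ℤ)
      ((C.triple i).level (lam i) + ∑ k, δ k * (C.triple i).coroot k)).subset ?_
    rintro _ ⟨n, hn, rfl⟩
    exact Set.mem_biUnion ⟨n, hn, rfl⟩ ⟨(hn i).1, by simpa [cap] using (hn i).2⟩
  have hdrift : ∀ (i : ℕ) (hi : i < ℓ),
      ((fun n => C.drift n ⟨i, hi⟩) '' C.latticePolytope lam).Finite := by
    intro i
    induction i with
    | zero =>
      intro hi
      refine (Set.finite_singleton 0).subset ?_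
      rintro _ ⟨n, _, rfl⟩
      rfl
    | succ i ih =>
      intro hi
      have h0 := ih (i.lt_succ_self.trans hi)
      refine ((h0.prod (hstep _ h0)).image fun v =>
        ((C.γ ⟨i, i.lt_succ_self.trans hi⟩ hi).map (Int.cast : ℤ → ℤ)).mulVec
          ((C.triple ⟨i, i.lt_succ_self.trans hi⟩).reflectAdd v.1 v.2)).subset ?_
      rintro _ ⟨n, hn, rfl⟩
      exact ⟨(C.drift n ⟨i, i.lt_succ_self.trans hi⟩, n ⟨i, i.lt_succ_self.trans hi⟩),
        ⟨⟨n, hn, rfl⟩, ⟨n, hn, rfl⟩⟩, rfl⟩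
  refine (Set.Finite.pi fun i => hstep i (hdrift i.1 i.2)).subset fun n hn i _ => ⟨n, hn, rfl⟩

lemma weightSet_eq (lam : C.Weight) : C.weightSet lam = C.latticePolytope lam := by
  set c : ℂ := ∏ i, (-1) ^ (C.triple i).level (lam i) with hc
  have hc0 : c ≠ 0 := Finset.prod_ne_zero_iff.2 fun i _ => zpow_ne_zero _ (by simp)
  ext n
  constructor
  · rintro ⟨f, hf, h⟩
    refine C.mem_latticePolytope_of_le hf hc0 fun r B hr hB => ?_
    have hn : ∀ i, ‖((r i : ℝ) : ℂ)‖ = r i := fun i => by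
      rw [Complex.norm_real, Real.norm_of_nonneg (hr i).le]
    have h1 := hB (fun i => (r i : ℂ)) hn
    rw [h _ fun i => by exact_mod_cast (hr i).ne', C.cSection_affinePoint, norm_mul, norm_prod,
      mul_comm] at h1
    simpa only [norm_zpow, hn] using h1
  · intro hn
    refine ⟨(c / C.monomialSign lam n) • C.monomialSection lam n,
      Submodule.smul_mem _ _ (C.monomialSection_mem hn), fun z _ => ?_⟩
    rw [Pi.smul_apply, C.monomialSection_affinePoint hn, C.cSection_affinePoint, smul_eq_mul,
      ← mul_assoc, div_mul_cancel₀ _ C.monomialSign_ne_zero, mul_comm]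
    congr 1
    refine Finset.prod_congr rfl fun i _ => ?_
    rw [← zpow_natCast, Int.toNat_of_nonneg (hn i).1]

/-- The monomial section with exponent in the polytope, as an element of the space of sections. -/
noncomputable def monomial (n : C.latticePolytope lam) : C.sections lam :=
  ⟨C.monomialSection lam n.1, C.monomialSection_mem n.2⟩

/-- The restriction of sections to the points with non-zero affine coordinates. -/
def restrict (lam : C.Weight) : C.sections lam →ₗ[ℂ] ((Fin ℓ → ℂˣ) → ℂ) where
  toFun f z := f.1 (C.affinePoint fun i => z i)
  map_add' _ _ := rfl
  map_smul' _ _ := rfl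

lemma linearIndependent_monomial (lam : C.Weight) :
    LinearIndependent ℂ (C.monomial : C.latticePolytope lam → C.sections lam) := by
  let χ : (Fin ℓ → ℤ) → ((Fin ℓ → ℂˣ) →* ℂ) := fun n => (Units.coeHom ℂ).comp
    { toFun := Torus.char n, map_one' := Torus.char_one n, map_mul' := Torus.char_mul n }
  have hχ : Function.Injective χ := by
    intro n m h
    funext i
    have h1 := DFunLike.congr_fun h (Pi.mulSingle i (Units.mk0 2 two_ne_zero))
    have h2 : ∀ n : Fin ℓ → ℤ, χ n (Pi.mulSingle i (Units.mk0 2 two_ne_zero)) = 2 ^ n i := by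
      intro n
      change ((Torus.char n _ : ℂˣ) : ℂ) = _
      rw [Torus.char, Finset.prod_eq_single i]
      · simp
      · intro j _ hj
        simp [Pi.mulSingle_eq_of_ne hj]
      · simp
    rw [h2, h2] at h1
    have h3 : (2 : ℝ) ^ n i = 2 ^ m i := by
      have := congrArg Norm.norm h1
      simpa only [norm_zpow, Complex.norm_ofNat] using this
    exact zpow_right_injective₀ (by norm_num) (by norm_num) h3
  have hli : LinearIndependent ℂ (fun n : C.latticePolytope lam => (χ n.1 : (Fin ℓ → ℂˣ) → ℂ)) :=
    (linearIndependent_monoidHom (Fin ℓ → ℂˣ) ℂ).comp _ (hχ.comp Subtype.val_injective)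
  have hli' := hli.units_smul fun n => Units.mk0 (C.monomialSign lam n.1) C.monomialSign_ne_zero
  refine LinearIndependent.of_comp (C.restrict lam) ?_
  convert hli' using 1
  funext n z
  change C.monomialSection lam n.1 (C.affinePoint fun i => z i) =
    C.monomialSign lam n.1 * ((Torus.char n.1 z : ℂˣ) : ℂ)
  rw [C.monomialSection_affinePoint n.2, Torus.char, Units.coe_prod]
  congr 1
  refine Finset.prod_congr rfl fun i _ => ?_
  rw [Units.val_zpow_eq_zpow_val, ← zpow_natCast, Int.toNat_of_nonneg (n.2 i).1]

/-- The monomial sections span, because a section is a polynomial in the affine coordinates and by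
Cauchy's estimate only exponents in the polytope occur. -/
lemma span_monomial (lam : C.Weight) :
    ⊤ ≤ Submodule.span ℂ (Set.range (C.monomial : C.latticePolytope lam → C.sections lam)) := by
  classical
  rintro ⟨f, hf⟩ -
  obtain ⟨B, hB0, hB⟩ := C.exists_norm_le hf
  obtain ⟨M, hM⟩ := C.exists_height_le lam
  obtain ⟨a, ha⟩ := PolynomialGrowth.exists_eq_sum M (C.differentiable_affinePoint hf.1) (B := B)
    (fun z => by
      obtain ⟨X, Q, hQ, hle⟩ := hB z
      exact hle.trans (mul_le_mul_of_nonneg_left (hM z X Q hQ) hB0.le))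
  have hmem : ∀ n, a n ≠ 0 → (fun i => ((n i : ℕ) : ℤ)) ∈ C.latticePolytope lam := by
    intro n hn
    refine C.mem_latticePolytope_of_le hf hn fun r B hr hB => ?_
    simp only [zpow_natCast]
    refine PolynomialGrowth.norm_coeff_mul_prod_le (a := a) hr (fun z hz => ?_) n
    rw [← ha]
    exact hB z hz
  let φ : (Fin ℓ → Fin (M + 1)) → C.sections lam := fun n =>
    if hn : (fun i => ((n i : ℕ) : ℤ)) ∈ C.latticePolytope lam then
      (a n / C.monomialSign lam fun i => ((n i : ℕ) : ℤ)) • C.monomial ⟨_, hn⟩ else 0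
  have hφ : ∀ n z, (φ n).1 (C.affinePoint z) = a n * ∏ i, z i ^ (n i : ℕ) := by
    intro n z
    simp only [φ]
    split_ifs with hn
    · change (a n / _) * C.monomialSection lam _ (C.affinePoint z) = _
      rw [C.monomialSection_affinePoint hn, ← mul_assoc, div_mul_cancel₀ _ C.monomialSign_ne_zero]
      simp
    · have h0 : a n = 0 := by
        by_contra h0
        exact hn (hmem n h0)
      rw [h0, zero_mul]
      rfl
  have hsum : (⟨f, hf⟩ : C.sections lam) = ∑ n, φ n := by
    rw [← sub_eq_zero]
    apply Subtype.ext
    refine C.eq_zero_of_affinePoint lam (Subtype.prop _) fun z => ?_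
    rw [Submodule.coe_sub, Submodule.coe_sum, Pi.sub_apply, Finset.sum_apply]
    simp only [hφ, ← ha, sub_self]
  rw [hsum]
  refine Submodule.sum_mem _ fun n _ => ?_
  simp only [φ]
  split_ifs with hn
  · exact Submodule.smul_mem _ _ (Submodule.subset_span ⟨_, rfl⟩)
  · exact Submodule.zero_mem _

/-- The basis of the space of sections that consists of the monomial sections. -/
noncomputable def monomialBasis (lam : C.Weight) :
    Module.Basis (C.latticePolytope lam) ℂ (C.sections lam) :=
  Module.Basis.mk (C.linearIndependent_monomial lam) (C.span_monomial lam)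

lemma trace_pullback (lam : C.Weight) (h : C.T) :
    LinearMap.trace ℂ (C.sections lam) (C.pullback lam h) =
      ∑ n ∈ (C.finite_latticePolytope lam).toFinset,
        ((∏ i, Torus.char (C.covector n i) (h i) : ℂˣ) : ℂ) := by
  classical
  have := (C.finite_latticePolytope lam).fintype
  rw [LinearMap.trace_eq_matrix_trace ℂ (C.monomialBasis lam), Matrix.trace,
    Finset.sum_subtype (C.finite_latticePolytope lam).toFinset (p := (· ∈ C.latticePolytope lam))
      fun n => Set.Finite.mem_toFinset _]
  refine Finset.sum_congr rfl fun n _ => ?_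
  have h1 : C.pullback lam h (C.monomialBasis lam n) =
      ((∏ i, Torus.char (C.covector n.1 i) (h i) : ℂˣ) : ℂ) • C.monomialBasis lam n := by
    rw [monomialBasis, Module.Basis.mk_apply]
    exact C.pullback_monomialSection n.2 h
  rw [Matrix.diag_apply, LinearMap.toMatrix_apply, h1, map_smul, Module.Basis.repr_self]
  simp

end P1Chain

theorem corollary7p4 {ℓ : ℕ} (C : P1Chain ℓ) (lam : C.Weight) (hpos : C.IsPositive lam) :
    Module.Finite ℂ (C.sections lam) ∧
    ∃ wts : Finset (Fin ℓ → ℤ),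
      (∀ η : Fin ℓ → ℤ, η ∈ wts ↔ η ∈ C.weightSet lam) ∧
      (∀ η : Fin ℓ → ℤ, η ∈ wts ↔ (fun i => (η i : ℝ)) ∈ C.momentPolytope lam) ∧
      ∀ H : C.LieT,
        LinearMap.trace ℂ (C.sections lam) (C.pullback lam (C.expI H)) =
          ∑ η ∈ wts, Complex.exp (Complex.I * (C.pairing (fun i => (η i : ℝ)) H : ℂ)) ∧
        LinearMap.trace ℂ (C.sections lam) (C.rep lam (C.expI H)) =
          ∑ η ∈ wts, Complex.exp (-(Complex.I * (C.pairing (fun i => (η i : ℝ)) H : ℂ))) := by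
  have hfin := C.finite_latticePolytope lam
  have := hfin.to_subtype
  refine ⟨Module.Finite.of_basis (C.monomialBasis lam), hfin.toFinset, fun η => ?_, fun η => ?_,
    fun H => ⟨?_, ?_⟩⟩
  · rw [Set.Finite.mem_toFinset, C.weightSet_eq]
  · rw [Set.Finite.mem_toFinset, C.mem_momentPolytope_iff hpos]
    refine forall_congr' fun i => ?_
    rw [← P1Chain.intCast_cap]
    norm_cast
  · rw [C.trace_pullback]
    exact Finset.sum_congr rfl fun η _ => C.prod_char_covector_expI η H
  · rw [P1Chain.rep, C.trace_pullback]
    refine Finset.sum_congr rfl fun η _ => ?_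
    rw [Complex.exp_neg, ← C.prod_char_covector_expI, ← Units.val_inv_eq_inv_val,
      ← Finset.prod_inv_distrib]
    simp only [Pi.inv_apply, Torus.char_inv]
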